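/- Let $H\in(1/2,1)$, $\sigma>0$, $s_0>0$, and let $\xi_1,\xi_2,\dots$ be i.i.d. random variables on a probability space $(\Omega,\mathcal F,P)$ with $P(\xi_i=1)=P(\xi_i=-1)=1/2$. Put $\mathcal F_n=\sigma(\xi_1,\dots,\xi_n)$, with $\mathcal F_0$ trivial. Let $C_H=(H-\tfrac12)\sqrt{\frac{2H\,\Gamma(3/2-H)}{\Gamma(H+1/2)\,\Gamma(2-2H)}}$ and, for $1\le i<n$, $$j_n(i)=\sigma C_H\int_{i-1}^{i}x^{\frac12-H}\Big(\int_0^1(v+n-1)^{H-\frac12}(v+n-1-x)^{H-\frac32}dv\Big)dx,$$ $$g_n=\sigma C_H\int_{n-1}^{n}x^{\frac12-H}(n-x)^{H-\frac12}\Big(\int_0^1(y(n-x)+x)^{H-\frac12}y^{H-\frac32}dy\Big)dx .$$ Set $\mathcal Y_n=\sum_{i=1}^{n-1}j_n(i)\xi_i$ and $X_n=\mathcal Y_n+g_n\xi_n$ for $n\ge1$, and $g_0=\mathcal Y_0=X_0=0$. For $N\ge1$, the (driftless) $N$-fractional binary market has bond $B^N_n=1$ and stock $S^N_0=s_0$,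 $S^N_n=(1+X_nN^{-H})S^N_{n-1}$, $n=1,\dots,N$. A frictionless self-financing strategy with zero endowment is an adapted process $\phi=(\phi^0_n,\phi^1_n)_{n=-1}^N$ of bond and stock positions with $\phi^0_{-1}=\phi^1_{-1}=0$ and $\phi^0_n-\phi^0_{n-1}\le-(\phi^1_n-\phi^1_{n-1})S^N_n$ for $0\le n\le N$; its value is $V_n(\phi)=\phi^0_n+\phi^1_nS^N_n$. For $k\ge1$ let $\theta^{(1)}_k=g_{k-1}g_k\xi_{k-1}\xi_k$, $\theta^{(2)}_k=g_k\xi_k\mathcal Y_{k-1}$, $\theta^{(3)}_k=g_{k-1}\xi_{k-1}\mathcal Y_k$, $\theta^{(4)}_k=\mathcal Y_{k-1}\mathcal Y_k$ (so that $\theta_1^{(i)}=0$ for all $i$), and $\mathcal S^{(i)}_n=\sum_{k=1}^n\theta^{(i)}_k$. With $\varepsilon_N=\ln(N)\,N^{-\min(1/2,\,2-2H)}$ let $$T^{(N,i)}=\inf\{k\in\{1,\dots,N\}:\tfrac1N\mathcal S^{(i)}_k<-\varepsilon_N\}\quad(\inf\emptyset=\infty),$$ $$T_N=T^{(N,1)}\wedge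 T^{(N,2)}\wedge(T^{(N,3)}-1)\wedge(T^{(N,4)}-1).$$ Then there are constants $C_1^\theta,C_2^\theta>0$ such that, almost surely, $\sup_{1\le n\le N}|\theta^{(i)}_n|\le C_i^\theta N^{H-1/2}$ for all $N\ge1$ and $i=1,2$. For any such constants, put $$\hat c_N=4\varepsilon_N+\frac{C_1^\theta+C_2^\theta}{N^{3/2-H}},$$ and let $\psi^N$ be the strategy with zero endowment whose stock position is $$\psi^{1,N}_{-1}=\psi^{1,N}_0=0,\qquad \psi^{1,N}_k=\frac1{\sqrt{\hat c_N}}\,1_{\{k<T_N\}}\,N^{H-1}\frac{X_k}{S^N_k}\quad(1\le k\le N)$$ (read as $0$ where $S^N_k=0$, which can happen for finitely many $N$ only), and whose bond position is determined by $\psi^{0,N}_{-1}=0$ and the self-financing condition with equality. Then $(\psi^N)_{N\ge1}$ provides a strong asymptotic arbitrage: each $\psi^N$ is a self-financing strategy with zero endowment, and there are positive reals $c_N\to0$ and $C_N\to\infty$ such that, for every $N\ge1$ and every $n\in\{0,\dots,N\}$, $V_n(\psi^N)\ge-c_N$ almost surely, and $$\lim_{N\to\infty}P\big(V_N(\psi^N)\ge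 C_N\big)=1 .$$ -/

import Mathlib

open MeasureTheory ProbabilityTheory Filter Topology

namespace FractionalBinary

noncomputable section

/-! ### The driving noise -/

/-- `ξ 1, ξ 2, …` are independent fair signs under `P` (the value `ξ 0` plays no role). -/
structure IsFairSignSequence {Ω : Type*} [MeasurableSpace Ω] (P : Measure Ω)
    (ξ : ℕ → Ω → ℝ) : Prop where
  measurable : ∀ i, 1 ≤ i → Measurable (ξ i)
  indep : iIndepFun (fun i : ℕ => ξ (i + 1)) P
  prob_one : ∀ i, 1 ≤ i → P {ω | ξ i ω = 1} = 1 / 2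
  prob_neg_one : ∀ i, 1 ≤ i → P {ω | ξ i ω = -1} = 1 / 2

/-- The σ-algebra `F_n = σ(ξ 1, …, ξ n)`; `F_0` is trivial. -/
def info {Ω : Type*} (ξ : ℕ → Ω → ℝ) (n : ℕ) : MeasurableSpace Ω :=
  ⨆ i ∈ Finset.Icc 1 n, MeasurableSpace.comap (ξ i) inferInstance

/-! ### The fractional binary markets (without drift) -/

/-- The normalizing constant of the Molchan–Golosov kernel of fractional Brownian motion. -/
def kernelConst (H : ℝ) : ℝ :=
  (H - 1 / 2) *
    √(2 * H * Real.Gamma (3 / 2 - H) / (Real.Gamma (H + 1 / 2) * Real.Gamma (2 - 2 * H)))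

/-- The coefficient `j_n(i)`, used for `1 ≤ i ≤ n - 1`. -/
def jCoef (H σ : ℝ) (n i : ℕ) : ℝ :=
  σ * kernelConst H *
    ∫ x in ((i : ℝ) - 1)..(i : ℝ), x ^ (1 / 2 - H) *
      ∫ v in (0 : ℝ)..1, (v + n - 1) ^ (H - 1 / 2) * (v + n - 1 - x) ^ (H - 3 / 2)

/-- The coefficient `g_n` for `n ≥ 1`. By convention `g_0 = 0`, which amounts to `X_0 = 0`. -/
def gCoef (H σ : ℝ) (n : ℕ) : ℝ :=
  if n = 0 then 0 else
    σ * kernelConst H *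
      ∫ x in ((n : ℝ) - 1)..(n : ℝ), x ^ (1 / 2 - H) * (n - x) ^ (H - 1 / 2) *
        ∫ y in (0 : ℝ)..1, (y * (n - x) + x) ^ (H - 1 / 2) * y ^ (H - 3 / 2)

variable {Ω : Type*}

/-- `Y_n = ∑_{i=1}^{n-1} j_n(i) ξ_i`. -/
def yProc (H σ : ℝ) (ξ : ℕ → Ω → ℝ) (n : ℕ) (ω : Ω) : ℝ :=
  ∑ i ∈ Finset.Ico 1 n, jCoef H σ n i * ξ i ω

/-- `X_n = Y_n + g_n ξ_n` (and `X_0 = 0`). -/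
def xProc (H σ : ℝ) (ξ : ℕ → Ω → ℝ) (n : ℕ) (ω : Ω) : ℝ :=
  yProc H σ ξ n ω + gCoef H σ n * ξ n ω

/-- The stock price `S_n^N` of the `N`-fractional binary market; the bond is constantly `1`. -/
def stockPrice (H σ s₀ : ℝ) (ξ : ℕ → Ω → ℝ) (N : ℕ) : ℕ → Ω → ℝ
  | 0, _ => s₀
  | n + 1, ω => (1 + xProc H σ ξ (n + 1) ω / (N : ℝ) ^ H) * stockPrice H σ s₀ ξ N n ω

/-! ### Trading strategies -/

/-- A trading strategy `(φ_n^0, φ_n^1)`, `n = -1, 0, 1, …`, in bond and stock. The positions at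
time `-1`, before any information is available, are constants; a market with horizon `N` uses
the positions at times `-1, 0, …, N` only. -/
structure Strategy (Ω : Type*) where
  bondInit : ℝ
  stockInit : ℝ
  bond : ℕ → Ω → ℝ
  stock : ℕ → Ω → ℝ

/-- `Δ_n f = f_n - f_{n-1}` for a process `f` with value `init` at time `-1`. -/
def increment (init : ℝ) (f : ℕ → Ω → ℝ) : ℕ → Ω → ℝ
  | 0, ω => f 0 ω - init
  | n + 1, ω => f (n + 1) ω - f n ω

/-- `φ` is a `lam`-self-financing strategy for the price process `S` up to time `N`: it is adapted
to `σ(ξ_1, …, ξ_n)` and satisfies the self-financing inequality. -/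
structure IsSelfFinancing (ξ : ℕ → Ω → ℝ) (S : ℕ → Ω → ℝ) (lam : ℝ) (N : ℕ)
    (φ : Strategy Ω) : Prop where
  adapted_bond : ∀ n ≤ N, Measurable[info ξ n] (φ.bond n)
  adapted_stock : ∀ n ≤ N, Measurable[info ξ n] (φ.stock n)
  financing : ∀ n ≤ N, ∀ ω,
    increment φ.bondInit φ.bond n ω ≤
      -((increment φ.stockInit φ.stock n ω)⁺ * S n ω)
        + (1 - lam) * (increment φ.stockInit φ.stock n ω)⁻ * S n ω

/-- The liquidation value `V_n^lam(φ)`. -/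
def liquidationValue (S : ℕ → Ω → ℝ) (lam : ℝ) (φ : Strategy Ω) (n : ℕ) (ω : Ω) : ℝ :=
  φ.bond n ω + (1 - lam) * (φ.stock n ω)⁺ * S n ω - (φ.stock n ω)⁻ * S n ω

/-- The strategy with zero endowment (no bond and no stock at time `-1`) and stock position `φ1`,
whose bond position is given by the self-financing condition with equality. -/
def ofStock (S : ℕ → Ω → ℝ) (lam : ℝ) (φ1 : ℕ → Ω → ℝ) : Strategy Ω where
  bondInit := 0
  stockInit := 0
  bond n ω :=
    0 - ∑ k ∈ Finset.range (n + 1), (increment 0 φ1 k ω)⁺ * S k ω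
      + (1 - lam) * ∑ k ∈ Finset.range (n + 1), (increment 0 φ1 k ω)⁻ * S k ω
  stock := φ1

/-- The sequence of strategies `(φ N)_{N ≥ 1}` provides a strong asymptotic arbitrage in the
sequence of markets with price processes `S N`, horizon `N` and transaction costs `lam N`. -/
def ProvidesStrongAsymptoticArbitrage [MeasurableSpace Ω] (P : Measure Ω) (ξ : ℕ → Ω → ℝ)
    (S : ℕ → ℕ → Ω → ℝ) (lam : ℕ → ℝ) (φ : ℕ → Strategy Ω) : Prop :=
  (∀ N, 1 ≤ N → IsSelfFinancing ξ (S N) (lam N) N (φ N) ∧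
    (φ N).bondInit = 0 ∧ (φ N).stockInit = 0) ∧
  ∃ c C : ℕ → ℝ,
    (∀ N, 1 ≤ N → 0 < c N ∧ 0 < C N) ∧
    Tendsto c atTop (𝓝 0) ∧
    Tendsto C atTop atTop ∧
    (∀ N, 1 ≤ N → ∀ n ≤ N, ∀ᵐ ω ∂P, -c N ≤ liquidationValue (S N) (lam N) (φ N) n ω) ∧
    Tendsto (fun N => P {ω | C N ≤ liquidationValue (S N) (lam N) (φ N) N ω}) atTop (𝓝 1)

/-! ### The strategies -/

/-- `φ_0^{1,N} = 0` and `φ_k^{1,N} = N^{H-1} X_k / S_k^N` for `k ≥ 1`. -/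
def phiStock (H σ s₀ : ℝ) (ξ : ℕ → Ω → ℝ) (N k : ℕ) (ω : Ω) : ℝ :=
  if k = 0 then 0 else
    (N : ℝ) ^ (H - 1) * (xProc H σ ξ k ω / stockPrice H σ s₀ ξ N k ω)

/-- `θ_k^{(1)} = g_{k-1} g_k ξ_{k-1} ξ_k`, `k ≥ 1`. -/
def theta1 (H σ : ℝ) (ξ : ℕ → Ω → ℝ) (k : ℕ) (ω : Ω) : ℝ :=
  gCoef H σ (k - 1) * gCoef H σ k * ξ (k - 1) ω * ξ k ω

/-- `θ_k^{(2)} = g_k ξ_k Y_{k-1}`, `k ≥ 1`. -/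
def theta2 (H σ : ℝ) (ξ : ℕ → Ω → ℝ) (k : ℕ) (ω : Ω) : ℝ :=
  gCoef H σ k * ξ k ω * yProc H σ ξ (k - 1) ω

/-- `θ_k^{(3)} = g_{k-1} ξ_{k-1} Y_k`, `k ≥ 1`. -/
def theta3 (H σ : ℝ) (ξ : ℕ → Ω → ℝ) (k : ℕ) (ω : Ω) : ℝ :=
  gCoef H σ (k - 1) * ξ (k - 1) ω * yProc H σ ξ k ω

/-- `θ_k^{(4)} = Y_{k-1} Y_k`, `k ≥ 1`. -/
def theta4 (H σ : ℝ) (ξ : ℕ → Ω → ℝ) (k : ℕ) (ω : Ω) : ℝ :=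
  yProc H σ ξ (k - 1) ω * yProc H σ ξ k ω

/-- The partial sums `∑_{k=1}^n θ_k`. -/
def partialSum (θ : ℕ → Ω → ℝ) (n : ℕ) (ω : Ω) : ℝ :=
  ∑ k ∈ Finset.Icc 1 n, θ k ω

/-- The first `k ∈ {1, …, N}` with `(1/N) ∑_{l=1}^k θ_l < -ε`, and `∞` if there is none. -/
def dropTime (θ : ℕ → Ω → ℝ) (N : ℕ) (ε : ℝ) (ω : Ω) : ℕ∞ :=
  ⨅ (k : ℕ) (_ : k ∈ Finset.Icc 1 N ∧ 1 / (N : ℝ) * partialSum θ k ω < -ε), (k : ℕ∞)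

/-- `ε_N = ln N / N^{min(1/2, 2-2H)}`. -/
def eps (H : ℝ) (N : ℕ) : ℝ :=
  Real.log N / (N : ℝ) ^ min (1 / 2) (2 - 2 * H)

/-- `T_N = T^{(1)} ∧ T^{(2)} ∧ (T^{(3)} - 1) ∧ (T^{(4)} - 1)`, where `∞ - 1 = ∞`. -/
def stopTime (H σ : ℝ) (ξ : ℕ → Ω → ℝ) (N : ℕ) (ω : Ω) : ℕ∞ :=
  min (min (dropTime (theta1 H σ ξ) N (eps H N) ω) (dropTime (theta2 H σ ξ) N (eps H N) ω))
    (min (dropTime (theta3 H σ ξ) N (eps H N) ω - 1)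
      (dropTime (theta4 H σ ξ) N (eps H N) ω - 1))

/-- The stopped stock position `1_{k < T_N} φ_k^{1,N}`. -/
def stoppedStock (H σ s₀ : ℝ) (ξ : ℕ → Ω → ℝ) (N k : ℕ) (ω : Ω) : ℝ :=
  if (k : ℕ∞) < stopTime H σ ξ N ω then phiStock H σ s₀ ξ N k ω else 0

/-- `C` is a positive constant with `sup_{1 ≤ n ≤ N} |θ_n| ≤ C N^{H-1/2}` for all `N ≥ 1`. -/
def IsThetaBound [MeasurableSpace Ω] (P : Measure Ω) (H : ℝ) (θ : ℕ → Ω → ℝ) (C : ℝ) : Prop :=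
  0 < C ∧ ∀ N : ℕ, 1 ≤ N → ∀ n ∈ Finset.Icc 1 N, ∀ᵐ ω ∂P, |θ n ω| ≤ C * (N : ℝ) ^ (H - 1 / 2)

/-- `ĉ_N = 4 ε_N + C₁₂ / N^{3/2-H}`. -/
def cHat (H C₁₂ : ℝ) (N : ℕ) : ℝ :=
  4 * eps H N + C₁₂ / (N : ℝ) ^ (3 / 2 - H)

/-- The strategy `ψ^N`: the stopped stock position divided by `√ĉ_N`, with the bond position
given by the frictionless self-financing condition. -/
def psi (H σ s₀ C₁₂ : ℝ) (ξ : ℕ → Ω → ℝ) (N : ℕ) : Strategy Ω :=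
  ofStock (stockPrice H σ s₀ ξ N) 0
    (fun k ω => 1 / √(cHat H C₁₂ N) * stoppedStock H σ s₀ ξ N k ω)

end

end FractionalBinary

open scoped ENNReal

namespace FractionalBinary

/-! ### Estimates of the kernel coefficients -/

/-! Since `S_{k+1} - S_k = X_{k+1} N^{-H} S_k`, holding `N^{H-1} X_k / S_k` earns `X_k X_{k+1} / N`
in one step. Before scaling, the gain is thus an empirical lag-one autocovariance of `X`, and
expanding `X = Y + g ξ` splits it into the four normalized sums of the `θ^{(i)}`
(`sum_xProc_mul_eq`). Positive memory makes this autocovariance strictly positive in the limit.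

The sums of `θ^{(1)}` and `θ^{(2)}` are martingale transforms of the signs. The sum of `θ^{(3)}`
dominates such a transform, because `ξ_{k-1}^2 = 1` only contributes nonnegative terms. The
integrands have uniformly bounded second moments, so a maximal inequality bounds the probability of
a drop below `-ε_N N` by `D / (ln N)^2`. The exponent in `ε_N` matters only through being positive
and at most `1/2`.

The sum of `θ^{(4)}` is a quadratic form in the signs. Its mean grows linearly, because all kernel
coefficients are nonnegative and those near the diagonal are bounded below (`le_jCoef`). Its
variance is `O(n^{2H}) = o(n^2)`, by the covariance decay of `exists_sum_jCoef_mul_jCoef_le`.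
Convergence along a polynomial subsequence, with the oscillation in between controlled by sums of
squares, gives almost sure linear growth (`exists_ae_le_theta4`).

Stopping at `T_N` keeps the unscaled value above `-ĉ_N`: the sums of `θ^{(3)}` and `θ^{(4)}` are
known one step ahead, so only `θ^{(1)}` and `θ^{(2)}` can overshoot, each by a single term. With
probability tending to one no stopping occurs and the unscaled value exceeds a fixed positive
constant. Division by `√ĉ_N` turns the possible loss into `√ĉ_N → 0` and the gain into a constant
over `√ĉ_N → ∞`. -/

theorem kernelConst_pos {H : ℝ} (hH : 1 / 2 < H) (hH1 : H < 1) : 0 < kernelConst H := by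
  unfold kernelConst
  have h1 := Real.Gamma_pos_of_pos (s := 3 / 2 - H) (by linarith)
  have h2 := Real.Gamma_pos_of_pos (s := H + 1 / 2) (by linarith)
  have h3 := Real.Gamma_pos_of_pos (s := 2 - 2 * H) (by linarith)
  have : 0 < H - 1 / 2 := by linarith
  positivity

theorem integral_zero_one_rpow {r : ℝ} (hr : -1 < r) :
    ∫ v in (0 : ℝ)..1, v ^ r = 1 / (r + 1) := by
  rw [integral_rpow (Or.inl hr), Real.one_rpow, Real.zero_rpow (by linarith), sub_zero]

/-- The common constant in the upper bounds for the coefficients. -/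
noncomputable def coefBound (H σ : ℝ) : ℝ :=
  σ * kernelConst H * (1 / (H - 1 / 2) * (1 / (3 / 2 - H)))

theorem coefBound_pos {H σ : ℝ} (hH : 1 / 2 < H) (hH1 : H < 1) (hσ : 0 < σ) :
    0 < coefBound H σ := by
  have := kernelConst_pos hH hH1
  have h1 : 0 < H - 1 / 2 := by linarith
  have h2 : 0 < 3 / 2 - H := by linarith
  unfold coefBound
  positivity

/-- An integral of `x ^ (1/2 - H) * F x` over `[i - 1, i]` is at most `i ^ (1/2 - H) * B / (3/2 - H)`
when `|F| ≤ B`. -/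
theorem abs_integral_rpow_mul_le {H B : ℝ} (hH : 1 / 2 < H) (hH1 : H < 1) {i : ℕ} (hi : 1 ≤ i)
    {F : ℝ → ℝ} (hF : ∀ x ∈ Set.Ioo ((i : ℝ) - 1) i, |F x| ≤ B) :
    |∫ x in ((i : ℝ) - 1)..(i : ℝ), x ^ (1 / 2 - H) * F x|
      ≤ (i : ℝ) ^ (1 / 2 - H) * B * (1 / (3 / 2 - H)) := by
  have hi' : (1 : ℝ) ≤ i := by exact_mod_cast hi
  have hintegrable : IntervalIntegrable (fun u : ℝ => u ^ (1 / 2 - H)) volume 0 1 :=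
    intervalIntegral.intervalIntegrable_rpow' (by linarith)
  have hintegrable_shift : IntervalIntegrable
      (fun x : ℝ => (i : ℝ) ^ (1 / 2 - H) * B * (x - ((i : ℝ) - 1)) ^ (1 / 2 - H)) volume
      ((i : ℝ) - 1) i := by
    have := hintegrable.comp_sub_right ((i : ℝ) - 1)
    simp only [zero_add, add_sub_cancel] at this
    exact this.const_mul _
  have key : ∫ x in ((i : ℝ) - 1)..(i : ℝ),
      (i : ℝ) ^ (1 / 2 - H) * B * (x - ((i : ℝ) - 1)) ^ (1 / 2 - H)
      = (i : ℝ) ^ (1 / 2 - H) * B * (1 / (3 / 2 - H)) := by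
    rw [intervalIntegral.integral_const_mul,
      intervalIntegral.integral_comp_sub_right (fun u : ℝ => u ^ (1 / 2 - H)) ((i : ℝ) - 1)]
    rw [sub_self, sub_sub_cancel, integral_zero_one_rpow (by linarith)]
    congr 2
    ring
  rw [← key, ← Real.norm_eq_abs]
  refine intervalIntegral.norm_integral_le_of_norm_le (by linarith) ?_ hintegrable_shift
  have hne : ∀ᵐ x : ℝ, x ≠ i := by simp [ae_iff]
  filter_upwards [hne] with x hx hxI
  have hxi : x < i := lt_of_le_of_ne hxI.2 hx
  have hu : 0 < x - ((i : ℝ) - 1) := by linarith [hxI.1]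
  have hx0 : 0 < x := by linarith [hxI.1]
  -- Equivalent to `(i - 1) (x - i) ≤ 0`. With `u = x - (i - 1)` in `(0, 1]`, it gives one
  -- integrable majorant for every `i`, including `i = 1`, where the integrand is singular.
  have hle : (i : ℝ) * (x - ((i : ℝ) - 1)) ≤ x := by nlinarith
  have h1 : x ^ (1 / 2 - H) ≤ (i : ℝ) ^ (1 / 2 - H) * (x - ((i : ℝ) - 1)) ^ (1 / 2 - H) := by
    rw [← Real.mul_rpow (by linarith) hu.le]
    exact Real.rpow_le_rpow_of_nonpos (by positivity) hle (by linarith)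
  rw [Real.norm_eq_abs, abs_mul, abs_of_nonneg (Real.rpow_nonneg hx0.le _)]
  calc x ^ (1 / 2 - H) * |F x|
      ≤ ((i : ℝ) ^ (1 / 2 - H) * (x - ((i : ℝ) - 1)) ^ (1 / 2 - H)) * B := by
        gcongr
        exact hF x ⟨hxI.1, hxi⟩
    _ = _ := by ring

theorem jCoef_nonneg {H σ : ℝ} (hH : 1 / 2 < H) (hH1 : H < 1) (hσ : 0 < σ) {n i : ℕ}
    (hi : 1 ≤ i) (hin : i < n) : 0 ≤ jCoef H σ n i := by
  have hi' : (1 : ℝ) ≤ i := by exact_mod_cast hi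
  have hin' : (i : ℝ) + 1 ≤ n := by exact_mod_cast hin
  have := kernelConst_pos hH hH1
  unfold jCoef
  refine mul_nonneg (by positivity) (intervalIntegral.integral_nonneg (by linarith) ?_)
  intro x hx
  refine mul_nonneg (Real.rpow_nonneg (by linarith [hx.1]) _)
    (intervalIntegral.integral_nonneg zero_le_one ?_)
  intro v hv
  exact mul_nonneg (Real.rpow_nonneg (by linarith [hv.1]) _)
    (Real.rpow_nonneg (by linarith [hv.1, hx.2]) _)

/-- The inner integrand is compared with `v ^ (H - 3/2)`, whose integral converges since `H > 1/2`.
The case `i = n - 1`, where the kernel touches its singularity, is therefore not exceptional. -/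
theorem jCoef_le {H σ : ℝ} (hH : 1 / 2 < H) (hH1 : H < 1) (hσ : 0 < σ) {n i : ℕ}
    (hi : 1 ≤ i) (hin : i < n) :
    jCoef H σ n i ≤ coefBound H σ *
      ((n : ℝ) ^ (H - 1 / 2) * (i : ℝ) ^ (1 / 2 - H) * ((n - i : ℕ) : ℝ) ^ (H - 3 / 2)) := by
  have hi' : (1 : ℝ) ≤ i := by exact_mod_cast hi
  have hin' : (i : ℝ) + 1 ≤ n := by exact_mod_cast hin
  have hκ := kernelConst_pos hH hH1
  rw [Nat.cast_sub hin.le]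
  have hni : (1 : ℝ) ≤ (n : ℝ) - i := by linarith
  set D : ℝ := (n : ℝ) ^ (H - 1 / 2) * ((n : ℝ) - i) ^ (H - 3 / 2) with hD
  have hD0 : 0 ≤ D := mul_nonneg (by positivity) (Real.rpow_nonneg (by linarith) _)
  have inner : ∀ x ∈ Set.Ioo ((i : ℝ) - 1) i,
      |∫ v in (0 : ℝ)..1, (v + n - 1) ^ (H - 1 / 2) * (v + n - 1 - x) ^ (H - 3 / 2)|
        ≤ D * (1 / (H - 1 / 2)) := by
    intro x hx
    have hintegrable : IntervalIntegrable (fun v : ℝ => D * v ^ (H - 3 / 2)) volume 0 1 :=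
      (intervalIntegral.intervalIntegrable_rpow' (by linarith)).const_mul _
    have : ∫ v in (0 : ℝ)..1, D * v ^ (H - 3 / 2) = D * (1 / (H - 1 / 2)) := by
      rw [intervalIntegral.integral_const_mul, integral_zero_one_rpow (by linarith)]
      congr 2
      ring
    rw [← this, ← Real.norm_eq_abs]
    refine intervalIntegral.norm_integral_le_of_norm_le zero_le_one
      (Eventually.of_forall fun v hv => ?_) hintegrable
    have h1 : 0 ≤ v + n - 1 := by linarith [hv.1]
    -- This is `(n - i - 1) (1 - v) ≥ 0` combined with `x < i`.
    have h2 : ((n : ℝ) - i) * v ≤ v + n - 1 - x := by nlinarith [hv.1, hv.2, hx.2]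
    have h3 : 0 < ((n : ℝ) - i) * v := mul_pos (by linarith) hv.1
    rw [Real.norm_eq_abs, abs_of_nonneg (mul_nonneg (Real.rpow_nonneg h1 _)
      (Real.rpow_nonneg (h3.le.trans h2) _)), hD, mul_assoc,
      ← Real.mul_rpow (by linarith) hv.1.le]
    refine mul_le_mul (Real.rpow_le_rpow h1 (by linarith [hv.2]) (by linarith))
      (Real.rpow_le_rpow_of_nonpos h3 h2 (by linarith))
      (Real.rpow_nonneg (h3.le.trans h2) _) (by positivity)
  have := (le_abs_self _).trans (abs_integral_rpow_mul_le hH hH1 hi inner)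
  unfold jCoef
  refine (mul_le_mul_of_nonneg_left this (by positivity)).trans (le_of_eq ?_)
  rw [hD, coefBound]
  ring

theorem gCoef_nonneg {H σ : ℝ} (hH : 1 / 2 < H) (hH1 : H < 1) (hσ : 0 < σ) (n : ℕ) :
    0 ≤ gCoef H σ n := by
  have := kernelConst_pos hH hH1
  unfold gCoef
  split_ifs with h
  · exact le_rfl
  have hn : (1 : ℝ) ≤ n := by exact_mod_cast Nat.one_le_iff_ne_zero.2 h
  refine mul_nonneg (by positivity) (intervalIntegral.integral_nonneg (by linarith) ?_)
  intro x hx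
  refine mul_nonneg (mul_nonneg (Real.rpow_nonneg (by linarith [hx.1]) _)
    (Real.rpow_nonneg (by linarith [hx.2]) _)) (intervalIntegral.integral_nonneg zero_le_one ?_)
  intro y hy
  refine mul_nonneg (Real.rpow_nonneg ?_ _) (Real.rpow_nonneg hy.1 _)
  have := mul_nonneg hy.1 (sub_nonneg.2 hx.2)
  linarith [hx.1]

theorem gCoef_le {H σ : ℝ} (hH : 1 / 2 < H) (hH1 : H < 1) (hσ : 0 < σ) (n : ℕ) :
    gCoef H σ n ≤ coefBound H σ := by
  have hκ := kernelConst_pos hH hH1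
  unfold gCoef
  split_ifs with h
  · exact (coefBound_pos hH hH1 hσ).le
  have hn1 : 1 ≤ n := Nat.one_le_iff_ne_zero.2 h
  have hn : (1 : ℝ) ≤ n := by exact_mod_cast hn1
  set D : ℝ := (n : ℝ) ^ (H - 1 / 2) with hD
  have hD0 : 0 < D := by positivity
  have inner : ∀ x ∈ Set.Ioo ((n : ℝ) - 1) n,
      |(n - x) ^ (H - 1 / 2) *
        ∫ y in (0 : ℝ)..1, (y * (n - x) + x) ^ (H - 1 / 2) * y ^ (H - 3 / 2)|
        ≤ D * (1 / (H - 1 / 2)) := by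
    intro x hx
    have hintegrable : IntervalIntegrable (fun v : ℝ => D * v ^ (H - 3 / 2)) volume 0 1 :=
      (intervalIntegral.intervalIntegrable_rpow' (by linarith)).const_mul _
    have : ∫ v in (0 : ℝ)..1, D * v ^ (H - 3 / 2) = D * (1 / (H - 1 / 2)) := by
      rw [intervalIntegral.integral_const_mul, integral_zero_one_rpow (by linarith)]
      congr 2
      ring
    rw [abs_mul, ← this, ← one_mul (∫ v in (0 : ℝ)..1, D * v ^ (H - 3 / 2))]
    have hnx : 0 ≤ n - x := by linarith [hx.2]
    refine mul_le_mul ?_ ?_ (abs_nonneg _) zero_le_one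
    · rw [abs_of_nonneg (Real.rpow_nonneg hnx _)]
      exact Real.rpow_le_one hnx (by linarith [hx.1]) (by linarith)
    rw [← Real.norm_eq_abs]
    refine intervalIntegral.norm_integral_le_of_norm_le zero_le_one
      (Eventually.of_forall fun v hv => ?_) hintegrable
    have h1 : 0 ≤ v * (n - x) + x := by
      have := mul_nonneg hv.1.le hnx
      linarith [hx.1]
    have h2 : v * (n - x) + x ≤ n := by nlinarith [hv.2]
    rw [Real.norm_eq_abs, abs_of_nonneg (mul_nonneg (Real.rpow_nonneg h1 _)
      (Real.rpow_nonneg hv.1.le _))]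
    exact mul_le_mul_of_nonneg_right (Real.rpow_le_rpow h1 h2 (by linarith))
      (Real.rpow_nonneg hv.1.le _)
  have := (le_abs_self _).trans (abs_integral_rpow_mul_le hH hH1 hn1 inner)
  simp only [← mul_assoc] at this ⊢
  refine (mul_le_mul_of_nonneg_left this (show 0 ≤ σ * kernelConst H by positivity)).trans
    (le_of_eq ?_)
  have hDn : (n : ℝ) ^ (1 / 2 - H) * D = 1 := by
    rw [hD, ← Real.rpow_add (by linarith)]
    simp
  rw [hDn, coefBound]
  ring

/-- The coefficients just below the diagonal are bounded away from zero. -/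
theorem le_jCoef {H σ : ℝ} (hH : 1 / 2 < H) (hH1 : H < 1) (hσ : 0 < σ) {n i : ℕ}
    (hi : 2 ≤ i) (hin : i + 2 ≤ n) (hni : n ≤ i + 3) :
    σ * kernelConst H * (4 : ℝ) ^ (H - 3 / 2) ≤ jCoef H σ n i := by
  have hi' : (2 : ℝ) ≤ i := by exact_mod_cast hi
  have hin' : (i : ℝ) + 2 ≤ n := by exact_mod_cast hin
  have hni' : (n : ℝ) ≤ i + 3 := by exact_mod_cast hni
  have hκ := kernelConst_pos hH hH1
  unfold jCoef
  refine mul_le_mul_of_nonneg_left ?_ (by positivity)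
  have hle : (i : ℝ) - 1 ≤ i := by linarith
  have hswap : ∀ x : ℝ, x ^ (1 / 2 - H) *
      ∫ v in (0 : ℝ)..1, (v + n - 1) ^ (H - 1 / 2) * (v + n - 1 - x) ^ (H - 3 / 2)
      = ∫ v in (0 : ℝ)..1, x ^ (1 / 2 - H) *
        ((v + n - 1) ^ (H - 1 / 2) * (v + n - 1 - x) ^ (H - 3 / 2)) :=
    -- With the outer factor inside, the integrand is jointly continuous on a compact rectangle, and
    -- Fubini yields integrability of the outer function.
    fun x => (intervalIntegral.integral_const_mul _ _).symm
  simp only [hswap]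
  have hcont : ContinuousOn (fun p : ℝ × ℝ => p.1 ^ (1 / 2 - H) *
      ((p.2 + n - 1) ^ (H - 1 / 2) * (p.2 + n - 1 - p.1) ^ (H - 3 / 2)))
      (Set.Icc ((i : ℝ) - 1) i ×ˢ Set.Icc 0 1) := by
    refine ContinuousOn.mul (ContinuousOn.rpow_const (by fun_prop) ?_)
      (ContinuousOn.mul (ContinuousOn.rpow_const (by fun_prop) ?_)
        (ContinuousOn.rpow_const (by fun_prop) ?_))
    all_goals
      rintro ⟨x, v⟩ ⟨hx, hv⟩
      simp only [Set.mem_Icc] at hx hv ⊢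
      left
    · linarith [hx.1]
    · have : 0 < v + n - 1 := by linarith [hv.1]
      exact this.ne'
    · have : 0 < v + n - 1 - x := by linarith [hv.1, hx.2]
      exact this.ne'
  -- The first two powers multiply to at least `1` because `v + n - 1 ≥ x`, and the last base is at
  -- most `n - i + 1 ≤ 4`.
  have hlow : ∀ x ∈ Set.Icc ((i : ℝ) - 1) i, ∀ v ∈ Set.Icc (0 : ℝ) 1,
      (4 : ℝ) ^ (H - 3 / 2) ≤ x ^ (1 / 2 - H) *
        ((v + n - 1) ^ (H - 1 / 2) * (v + n - 1 - x) ^ (H - 3 / 2)) := by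
    intro x hx v hv
    have hx0 : 0 < x := by linarith [hx.1]
    have h1 : 1 ≤ x ^ (1 / 2 - H) * (v + n - 1) ^ (H - 1 / 2) := by
      have h3 : x ^ (H - 1 / 2) ≤ (v + n - 1) ^ (H - 1 / 2) :=
        Real.rpow_le_rpow hx0.le (by linarith [hx.2, hv.1]) (by linarith)
      have h4 : x ^ (1 / 2 - H) * x ^ (H - 1 / 2) = 1 := by
        rw [← Real.rpow_add hx0]
        simp
      exact h4.symm.le.trans (mul_le_mul_of_nonneg_left h3 (Real.rpow_nonneg hx0.le _))
    have h2 : (4 : ℝ) ^ (H - 3 / 2) ≤ (v + n - 1 - x) ^ (H - 3 / 2) :=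
      Real.rpow_le_rpow_of_nonpos (by linarith [hx.2, hv.1]) (by linarith [hx.1, hv.2])
        (by linarith)
    rw [← mul_assoc, ← one_mul ((4 : ℝ) ^ (H - 3 / 2))]
    exact mul_le_mul h1 h2 (by positivity) (by linarith)
  have hinner : ∀ x ∈ Set.Icc ((i : ℝ) - 1) i, (4 : ℝ) ^ (H - 3 / 2) ≤
      ∫ v in (0 : ℝ)..1, x ^ (1 / 2 - H) *
        ((v + n - 1) ^ (H - 1 / 2) * (v + n - 1 - x) ^ (H - 3 / 2)) := by
    intro x hx
    have hc : ContinuousOn (fun v : ℝ => x ^ (1 / 2 - H) *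
        ((v + n - 1) ^ (H - 1 / 2) * (v + n - 1 - x) ^ (H - 3 / 2))) (Set.Icc 0 1) :=
      hcont.comp (f := fun v : ℝ => (x, v)) (by fun_prop) (fun v hv => ⟨hx, hv⟩)
    have := intervalIntegral.integral_mono_on (a := (0 : ℝ)) (b := 1) zero_le_one
      (intervalIntegrable_const (c := (4 : ℝ) ^ (H - 3 / 2)))
      (hc.intervalIntegrable_of_Icc (μ := volume) zero_le_one) (hlow x hx)
    simpa using this
  have hintegrable : IntervalIntegrable (fun x : ℝ => ∫ v in (0 : ℝ)..1, x ^ (1 / 2 - H) *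
        ((v + n - 1) ^ (H - 1 / 2) * (v + n - 1 - x) ^ (H - 3 / 2))) volume ((i : ℝ) - 1) i := by
    have h1 : IntegrableOn (fun p : ℝ × ℝ => p.1 ^ (1 / 2 - H) *
      ((p.2 + n - 1) ^ (H - 1 / 2) * (p.2 + n - 1 - p.1) ^ (H - 3 / 2)))
      (Set.Icc ((i : ℝ) - 1) i ×ˢ Set.Icc 0 1) (volume.prod volume) :=
      hcont.integrableOn_compact (isCompact_Icc.prod isCompact_Icc)
    rw [IntegrableOn, ← Measure.prod_restrict] at h1
    have h2 := h1.integral_prod_left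
    rw [intervalIntegrable_iff_integrableOn_Icc_of_le hle]
    refine h2.congr (Eventually.of_forall fun x => ?_)
    simp only [intervalIntegral.integral_of_le zero_le_one, integral_Icc_eq_integral_Ioc]
  have := intervalIntegral.integral_mono_on hle
    (intervalIntegrable_const (c := (4 : ℝ) ^ (H - 3 / 2))) hintegrable hinner
  simpa using this

/-! ### Sums of powers and of the coefficients -/

theorem sum_rpow_le {r : ℝ} (hr : -1 < r) (hr0 : r ≤ 0) (n : ℕ) :
    ∑ m ∈ Finset.Ico 1 n, (m : ℝ) ^ r ≤ (n : ℝ) ^ (r + 1) / (r + 1) := by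
  have ht : 0 < r + 1 := by linarith
  have step : ∀ m : ℕ, ∑ k ∈ Finset.Ico 1 (m + 1), (k : ℝ) ^ r ≤ (m : ℝ) ^ (r + 1) / (r + 1) := by
    intro m
    induction m with
    | zero => simp [Real.zero_rpow ht.ne']
    | succ m ih =>
      rw [Finset.sum_Ico_succ_top (by omega)]
      have hm : (0 : ℝ) < ((m + 1 : ℕ) : ℝ) := by positivity
      have hb := rpow_one_add_le_one_add_mul_self (s := -(1 / ((m + 1 : ℕ) : ℝ)))
        (by
          rw [neg_le_neg_iff, div_le_one hm]
          exact_mod_cast Nat.succ_le_succ (Nat.zero_le m)) ht.le (by linarith)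
      have h1 : (m : ℝ) = ((m + 1 : ℕ) : ℝ) * (1 + -(1 / ((m + 1 : ℕ) : ℝ))) := by
        field_simp
        push_cast
        ring
      have h2 : (0 : ℝ) ≤ 1 + -(1 / ((m + 1 : ℕ) : ℝ)) := by
        have : 1 / ((m + 1 : ℕ) : ℝ) ≤ 1 := by
          rw [div_le_one hm]
          exact_mod_cast Nat.succ_le_succ (Nat.zero_le m)
        linarith
      -- Bernoulli's inequality for the exponent `r + 1` in `(0, 1]`; these differences telescope.
      have h3 : (m : ℝ) ^ (r + 1) ≤ ((m + 1 : ℕ) : ℝ) ^ (r + 1) - (r + 1) * ((m + 1 : ℕ) : ℝ) ^ r := by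
        calc (m : ℝ) ^ (r + 1)
            = ((m + 1 : ℕ) : ℝ) ^ (r + 1) * (1 + -(1 / ((m + 1 : ℕ) : ℝ))) ^ (r + 1) := by
              rw [← Real.mul_rpow hm.le h2, ← h1]
          _ ≤ ((m + 1 : ℕ) : ℝ) ^ (r + 1) * (1 + (r + 1) * -(1 / ((m + 1 : ℕ) : ℝ))) := by
              gcongr
          _ = _ := by
              rw [Real.rpow_add hm, Real.rpow_one]
              field_simp
              ring
      have h4 : (m : ℝ) ^ (r + 1) / (r + 1) + ((m + 1 : ℕ) : ℝ) ^ r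
          ≤ ((m + 1 : ℕ) : ℝ) ^ (r + 1) / (r + 1) := by
        rw [le_div_iff₀ ht, add_mul, div_mul_cancel₀ _ ht.ne']
        linarith
      linarith
  rcases n with _ | n
  · simp [Real.zero_rpow ht.ne']
  · refine (step n).trans ?_
    gcongr
    simp

/-- A discrete Beta integral is controlled by splitting it at the midpoint. -/
theorem sum_rpow_mul_rpow_le {r s : ℝ} (hr : r ≤ 0) (hs : s ≤ 0) (n : ℕ) :
    ∑ i ∈ Finset.Ico 1 n, (i : ℝ) ^ r * ((n - i : ℕ) : ℝ) ^ s
      ≤ ((n : ℝ) / 2) ^ r * ∑ m ∈ Finset.Ico 1 n, (m : ℝ) ^ s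
        + ((n : ℝ) / 2) ^ s * ∑ m ∈ Finset.Ico 1 n, (m : ℝ) ^ r := by
  have hrefl : ∑ m ∈ Finset.Ico 1 n, (m : ℝ) ^ s
      = ∑ i ∈ Finset.Ico 1 n, ((n - i : ℕ) : ℝ) ^ s := by
    rw [Finset.sum_Ico_reflect (fun m : ℕ => (m : ℝ) ^ s) 1 (Nat.le_succ n)]
    simp
  rw [hrefl, Finset.mul_sum, Finset.mul_sum, ← Finset.sum_add_distrib]
  refine Finset.sum_le_sum fun i hi => ?_
  rw [Finset.mem_Ico] at hi
  have hi1 : (1 : ℝ) ≤ i := by exact_mod_cast hi.1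
  have hni : (1 : ℝ) ≤ ((n - i : ℕ) : ℝ) := by
    exact_mod_cast (by omega : 1 ≤ n - i)
  have hsum : (i : ℝ) + ((n - i : ℕ) : ℝ) = n := by
    rw [Nat.cast_sub hi.2.le]
    ring
  have hn0 : (0 : ℝ) < (n : ℝ) / 2 := by linarith
  have p1 : 0 ≤ (i : ℝ) ^ r := by positivity
  have p2 : 0 ≤ ((n - i : ℕ) : ℝ) ^ s := by positivity
  rcases le_total ((n : ℝ) / 2) i with h | h
  · have h1 := mul_le_mul_of_nonneg_right (Real.rpow_le_rpow_of_nonpos hn0 h hr) p2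
    have h2 : 0 ≤ ((n : ℝ) / 2) ^ s * (i : ℝ) ^ r := by positivity
    linarith
  · have h' : (n : ℝ) / 2 ≤ ((n - i : ℕ) : ℝ) := by linarith
    have h1 := mul_le_mul_of_nonneg_right (Real.rpow_le_rpow_of_nonpos hn0 h' hs) p1
    have h2 : 0 ≤ ((n : ℝ) / 2) ^ r * ((n - i : ℕ) : ℝ) ^ s := by positivity
    linarith

theorem sum_rpow_mul_rpow_le_of_neg_one_lt {r s : ℝ} (hr : -1 < r) (hr0 : r ≤ 0) (hs : -1 < s)
    (hs0 : s ≤ 0) {n : ℕ} (hn : 1 ≤ n) :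
    ∑ i ∈ Finset.Ico 1 n, (i : ℝ) ^ r * ((n - i : ℕ) : ℝ) ^ s
      ≤ (((2 : ℝ) ^ r)⁻¹ / (s + 1) + ((2 : ℝ) ^ s)⁻¹ / (r + 1)) * (n : ℝ) ^ (r + s + 1) := by
  have hn' : (0 : ℝ) < n := by exact_mod_cast hn
  refine (sum_rpow_mul_rpow_le hr0 hs0 n).trans ?_
  have h1 := mul_le_mul_of_nonneg_left (sum_rpow_le hs hs0 n)
    (show 0 ≤ ((n : ℝ) / 2) ^ r by positivity)
  have h2 := mul_le_mul_of_nonneg_left (sum_rpow_le hr hr0 n)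
    (show 0 ≤ ((n : ℝ) / 2) ^ s by positivity)
  refine (add_le_add h1 h2).trans (le_of_eq ?_)
  have e1 : (n : ℝ) ^ (r + s + 1) = (n : ℝ) ^ r * (n : ℝ) ^ (s + 1) := by
    rw [← Real.rpow_add hn']
    congr 1
    ring
  have e2 : (n : ℝ) ^ (r + s + 1) = (n : ℝ) ^ s * (n : ℝ) ^ (r + 1) := by
    rw [← Real.rpow_add hn']
    congr 1
    ring
  rw [add_mul, Real.div_rpow hn'.le zero_le_two, Real.div_rpow hn'.le zero_le_two]
  nth_rewrite 1 [e1]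
  rw [e2]
  ring

/-- The exponents `1/2 - H` and `H - 3/2` sum to `-1`, so the discrete Beta sum is bounded and only
`n ^ (H - 1/2)` remains. Since signs have modulus one, this is a pathwise bound on `Y_n`. -/
theorem exists_sum_jCoef_le {H σ : ℝ} (hH : 1 / 2 < H) (hH1 : H < 1) (hσ : 0 < σ) :
    ∃ C : ℝ, 0 < C ∧ ∀ n : ℕ,
      ∑ i ∈ Finset.Ico 1 n, jCoef H σ n i ≤ C * (n : ℝ) ^ (H - 1 / 2) := by
  have hK := coefBound_pos hH hH1 hσ
  have d1 : 0 < H - 3 / 2 + 1 := by linarith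
  have d2 : 0 < 1 / 2 - H + 1 := by linarith
  refine ⟨coefBound H σ * (((2 : ℝ) ^ (1 / 2 - H))⁻¹ / (H - 3 / 2 + 1)
    + ((2 : ℝ) ^ (H - 3 / 2))⁻¹ / (1 / 2 - H + 1)), by positivity, fun n => ?_⟩
  rcases Nat.eq_zero_or_pos n with rfl | hn
  · simp only [Finset.Ico_eq_empty_of_le, zero_le, Finset.sum_empty]
    positivity
  have hb := sum_rpow_mul_rpow_le_of_neg_one_lt (r := 1 / 2 - H) (s := H - 3 / 2) (by linarith)
    (by linarith) (by linarith) (by linarith) hn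
  rw [show 1 / 2 - H + (H - 3 / 2) + 1 = 0 by ring, Real.rpow_zero, mul_one] at hb
  calc ∑ i ∈ Finset.Ico 1 n, jCoef H σ n i
      ≤ ∑ i ∈ Finset.Ico 1 n, coefBound H σ * (n : ℝ) ^ (H - 1 / 2) *
          ((i : ℝ) ^ (1 / 2 - H) * ((n - i : ℕ) : ℝ) ^ (H - 3 / 2)) := by
        refine Finset.sum_le_sum fun i hi => ?_
        rw [Finset.mem_Ico] at hi
        refine (jCoef_le hH hH1 hσ hi.1 hi.2).trans (le_of_eq (by ring))
    _ ≤ _ := by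
        rw [← Finset.mul_sum]
        refine (mul_le_mul_of_nonneg_left hb (by positivity)).trans (le_of_eq (by ring))

/-- Uniform boundedness of the variance of `Y_n`. After squaring, the exponent `2 H - 3` is below
`-1`, so that half of the Beta sum is controlled by a convergent series instead of a growing power.
-/
theorem exists_sum_jCoef_sq_le {H σ : ℝ} (hH : 1 / 2 < H) (hH1 : H < 1) (hσ : 0 < σ) :
    ∃ C : ℝ, 0 < C ∧ ∀ n : ℕ, ∑ i ∈ Finset.Ico 1 n, jCoef H σ n i ^ 2 ≤ C := by
  have hK := coefBound_pos hH hH1 hσ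
  have d2 : 0 < 1 - 2 * H + 1 := by linarith
  have hsm : Summable (fun m : ℕ => (m : ℝ) ^ (2 * H - 3)) :=
    Real.summable_nat_rpow.2 (by linarith)
  set Z := ∑' m : ℕ, (m : ℝ) ^ (2 * H - 3) with hZ
  have hZ0 : 0 ≤ Z := tsum_nonneg fun m => by positivity
  refine ⟨coefBound H σ ^ 2 * (((2 : ℝ) ^ (1 - 2 * H))⁻¹ * Z
    + ((2 : ℝ) ^ (2 * H - 3))⁻¹ / (1 - 2 * H + 1)), by positivity, fun n => ?_⟩
  rcases Nat.eq_zero_or_pos n with rfl | hn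
  · simp only [Finset.Ico_eq_empty_of_le, zero_le, Finset.sum_empty]
    positivity
  have hn' : (0 : ℝ) < n := by exact_mod_cast hn
  have hn1 : (1 : ℝ) ≤ n := by exact_mod_cast hn
  have hb := sum_rpow_mul_rpow_le (r := 1 - 2 * H) (s := 2 * H - 3) (by linarith) (by linarith) n
  have h1 : ∑ m ∈ Finset.Ico 1 n, (m : ℝ) ^ (2 * H - 3) ≤ Z :=
    hsm.sum_le_tsum _ fun m _ => by positivity
  have h2 := sum_rpow_le (r := 1 - 2 * H) (by linarith) (by linarith) n
  calc ∑ i ∈ Finset.Ico 1 n, jCoef H σ n i ^ 2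
      ≤ ∑ i ∈ Finset.Ico 1 n, coefBound H σ ^ 2 * (n : ℝ) ^ (2 * H - 1) *
          ((i : ℝ) ^ (1 - 2 * H) * ((n - i : ℕ) : ℝ) ^ (2 * H - 3)) := by
        refine Finset.sum_le_sum fun i hi => ?_
        rw [Finset.mem_Ico] at hi
        refine (pow_le_pow_left₀ (jCoef_nonneg hH hH1 hσ hi.1 hi.2)
          (jCoef_le hH hH1 hσ hi.1 hi.2) 2).trans (le_of_eq ?_)
        have e : ∀ (x r : ℝ), 0 ≤ x → (x ^ r) ^ 2 = x ^ (2 * r) := fun x r hx => by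
          rw [mul_comm, Real.rpow_mul hx, Real.rpow_two]
        rw [mul_pow, mul_pow, mul_pow, e _ _ (by positivity), e _ _ (by positivity),
          e _ _ (by positivity), show 2 * (H - 1 / 2) = 2 * H - 1 by ring,
          show 2 * (1 / 2 - H) = 1 - 2 * H by ring, show 2 * (H - 3 / 2) = 2 * H - 3 by ring]
        ring
    _ ≤ coefBound H σ ^ 2 * (n : ℝ) ^ (2 * H - 1) * (((n : ℝ) / 2) ^ (1 - 2 * H) * Z
        + ((n : ℝ) / 2) ^ (2 * H - 3) * ((n : ℝ) ^ (1 - 2 * H + 1) / (1 - 2 * H + 1))) := by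
        rw [← Finset.mul_sum]
        refine mul_le_mul_of_nonneg_left (hb.trans ?_) (by positivity)
        gcongr
    _ = coefBound H σ ^ 2 * (((2 : ℝ) ^ (1 - 2 * H))⁻¹ * Z
          * ((n : ℝ) ^ (2 * H - 1) * (n : ℝ) ^ (1 - 2 * H))
        + ((2 : ℝ) ^ (2 * H - 3))⁻¹ / (1 - 2 * H + 1) *
          ((n : ℝ) ^ (2 * H - 1) * (n : ℝ) ^ (2 * H - 3) * (n : ℝ) ^ (1 - 2 * H + 1))) := by
        rw [Real.div_rpow hn'.le zero_le_two, Real.div_rpow hn'.le zero_le_two]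
        ring
    _ ≤ _ := by
        rw [← Real.rpow_add hn', ← Real.rpow_add hn', ← Real.rpow_add hn']
        have e1 : (n : ℝ) ^ (2 * H - 1 + (1 - 2 * H)) ≤ 1 :=
          Real.rpow_le_one_of_one_le_of_nonpos hn1 (by linarith)
        have e2 : (n : ℝ) ^ (2 * H - 1 + (2 * H - 3) + (1 - 2 * H + 1)) ≤ 1 :=
          Real.rpow_le_one_of_one_le_of_nonpos hn1 (by linarith)
        refine mul_le_mul_of_nonneg_left (add_le_add ?_ ?_) (by positivity)
        · exact mul_le_of_le_one_right (by positivity) e1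
        · exact mul_le_of_le_one_right (by positivity) e2

/-- Decay of the covariance of `Y_k` and `Y_l`. -/
theorem exists_sum_jCoef_mul_jCoef_le {H σ : ℝ} (hH : 1 / 2 < H) (hH1 : H < 1) (hσ : 0 < σ) :
    ∃ C : ℝ, 0 < C ∧ ∀ k l : ℕ, k ≤ l →
      ∑ i ∈ Finset.Ico 1 k, jCoef H σ k i * jCoef H σ l i
        ≤ C * (l : ℝ) ^ (H - 1 / 2) * ((l - k + 1 : ℕ) : ℝ) ^ (H - 3 / 2) := by
  have hK := coefBound_pos hH hH1 hσ
  have d1 : 0 < H - 3 / 2 + 1 := by linarith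
  have d2 : 0 < 1 - 2 * H + 1 := by linarith
  refine ⟨coefBound H σ ^ 2 * (((2 : ℝ) ^ (1 - 2 * H))⁻¹ / (H - 3 / 2 + 1)
    + ((2 : ℝ) ^ (H - 3 / 2))⁻¹ / (1 - 2 * H + 1)), by positivity, fun k l hkl => ?_⟩
  rcases Nat.eq_zero_or_pos k with rfl | hk
  · simp only [Finset.Ico_eq_empty_of_le, zero_le, Finset.sum_empty]
    positivity
  have hk' : (0 : ℝ) < k := by exact_mod_cast hk
  have hb := sum_rpow_mul_rpow_le_of_neg_one_lt (r := 1 - 2 * H) (s := H - 3 / 2) (by linarith)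
    (by linarith) (by linarith) (by linarith) hk
  calc ∑ i ∈ Finset.Ico 1 k, jCoef H σ k i * jCoef H σ l i
      ≤ ∑ i ∈ Finset.Ico 1 k, coefBound H σ ^ 2 * (k : ℝ) ^ (H - 1 / 2) * (l : ℝ) ^ (H - 1 / 2)
          * ((l - k + 1 : ℕ) : ℝ) ^ (H - 3 / 2) *
          ((i : ℝ) ^ (1 - 2 * H) * ((k - i : ℕ) : ℝ) ^ (H - 3 / 2)) := by
        refine Finset.sum_le_sum fun i hi => ?_
        rw [Finset.mem_Ico] at hi
        have hi0 : (0 : ℝ) < i := by exact_mod_cast hi.1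
        have hil : i < l := hi.2.trans_le hkl
        refine (mul_le_mul (jCoef_le hH hH1 hσ hi.1 hi.2) (jCoef_le hH hH1 hσ hi.1 hil)
          (jCoef_nonneg hH hH1 hσ hi.1 hil) (by positivity)).trans ?_
        have e1 : (i : ℝ) ^ (1 - 2 * H) = (i : ℝ) ^ (1 / 2 - H) * (i : ℝ) ^ (1 / 2 - H) := by
          rw [← Real.rpow_add hi0]
          congr 1
          ring
        -- As `i < k`, the second kernel loses at most the gap `l - k + 1`. Pulling this factor out
        -- leaves a Beta sum of order `k ^ (1/2 - H)`, which cancels `k ^ (H - 1/2)`.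
        have e2 : ((l - i : ℕ) : ℝ) ^ (H - 3 / 2) ≤ ((l - k + 1 : ℕ) : ℝ) ^ (H - 3 / 2) :=
          Real.rpow_le_rpow_of_nonpos (by positivity)
            (by exact_mod_cast (by omega : l - k + 1 ≤ l - i)) (by linarith)
        rw [e1]
        calc _ = coefBound H σ ^ 2 * (k : ℝ) ^ (H - 1 / 2) * (l : ℝ) ^ (H - 1 / 2) *
            ((i : ℝ) ^ (1 / 2 - H) * (i : ℝ) ^ (1 / 2 - H) * ((k - i : ℕ) : ℝ) ^ (H - 3 / 2))
            * ((l - i : ℕ) : ℝ) ^ (H - 3 / 2) := by ring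
          _ ≤ coefBound H σ ^ 2 * (k : ℝ) ^ (H - 1 / 2) * (l : ℝ) ^ (H - 1 / 2) *
            ((i : ℝ) ^ (1 / 2 - H) * (i : ℝ) ^ (1 / 2 - H) * ((k - i : ℕ) : ℝ) ^ (H - 3 / 2))
            * ((l - k + 1 : ℕ) : ℝ) ^ (H - 3 / 2) :=
            mul_le_mul_of_nonneg_left e2 (by positivity)
          _ = _ := by ring
    _ ≤ coefBound H σ ^ 2 * (k : ℝ) ^ (H - 1 / 2) * (l : ℝ) ^ (H - 1 / 2)
          * ((l - k + 1 : ℕ) : ℝ) ^ (H - 3 / 2) *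
          ((((2 : ℝ) ^ (1 - 2 * H))⁻¹ / (H - 3 / 2 + 1)
          + ((2 : ℝ) ^ (H - 3 / 2))⁻¹ / (1 - 2 * H + 1)) * (k : ℝ) ^ (1 - 2 * H + (H - 3 / 2) + 1)) := by
        rw [← Finset.mul_sum]
        exact mul_le_mul_of_nonneg_left hb (by positivity)
    _ = coefBound H σ ^ 2 * (((2 : ℝ) ^ (1 - 2 * H))⁻¹ / (H - 3 / 2 + 1)
          + ((2 : ℝ) ^ (H - 3 / 2))⁻¹ / (1 - 2 * H + 1)) * (l : ℝ) ^ (H - 1 / 2)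
          * ((l - k + 1 : ℕ) : ℝ) ^ (H - 3 / 2) *
          ((k : ℝ) ^ (H - 1 / 2) * (k : ℝ) ^ (1 - 2 * H + (H - 3 / 2) + 1)) := by ring
    _ = _ := by
        rw [← Real.rpow_add hk', show H - 1 / 2 + (1 - 2 * H + (H - 3 / 2) + 1) = 0 by ring,
          Real.rpow_zero, mul_one]

/-! ### Martingale transforms of fair signs -/

section Signs

variable {Ω : Type*} {ξ : ℕ → Ω → ℝ}

theorem info_mono {m n : ℕ} (h : m ≤ n) : info ξ m ≤ info ξ n :=
  biSup_mono fun _ hi => Finset.Icc_subset_Icc_right h hi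

theorem measurable_info {i n : ℕ} (hi : 1 ≤ i) (hin : i ≤ n) : Measurable[info ξ n] (ξ i) := by
  have h : MeasurableSpace.comap (ξ i) inferInstance ≤ info ξ n :=
    le_biSup (fun i => MeasurableSpace.comap (ξ i) inferInstance) (Finset.mem_Icc.2 ⟨hi, hin⟩)
  exact Measurable.mono (comap_measurable (ξ i)) h le_rfl

/-- The martingale transform `∑_{k=1}^n ξ_k Z_k`. -/
def transform (ξ Z : ℕ → Ω → ℝ) (n : ℕ) (ω : Ω) : ℝ :=
  ∑ k ∈ Finset.Icc 1 n, ξ k ω * Z k ω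

theorem transform_succ (Z : ℕ → Ω → ℝ) (n : ℕ) (ω : Ω) :
    transform ξ Z (n + 1) ω = transform ξ Z n ω + ξ (n + 1) ω * Z (n + 1) ω := by
  unfold transform
  rw [Finset.sum_Icc_succ_top (by omega)]

theorem measurable_info_transform {Z : ℕ → Ω → ℝ}
    (hZ : ∀ k, 1 ≤ k → Measurable[info ξ (k - 1)] (Z k)) (n : ℕ) :
    Measurable[info ξ n] (transform ξ Z n) := by
  refine Finset.measurable_fun_sum _ fun k hk => ?_
  rw [Finset.mem_Icc] at hk
  exact (measurable_info hk.1 hk.2).mul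
    ((hZ k hk.1).mono (info_mono (by omega)) le_rfl)

variable [MeasurableSpace Ω] {P : Measure Ω}

theorem IsFairSignSequence.info_le (hξ : IsFairSignSequence P ξ) (n : ℕ) :
    info ξ n ≤ ‹MeasurableSpace Ω› :=
  iSup₂_le fun i hi => (hξ.measurable i (Finset.mem_Icc.1 hi).1).comap_le

theorem memLp_top_mul {f g : Ω → ℝ} (hf : MemLp f ∞ P) (hg : MemLp g ∞ P) :
    MemLp (fun ω => f ω * g ω) ∞ P :=
  hg.mul hf

theorem memLp_top_sq {f : Ω → ℝ} (hf : MemLp f ∞ P) : MemLp (fun ω => f ω ^ 2) ∞ P := by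
  simpa only [sq] using memLp_top_mul hf hf

variable [IsProbabilityMeasure P]

theorem IsFairSignSequence.ae_eq_one_or (hξ : IsFairSignSequence P ξ) :
    ∀ᵐ ω ∂P, ∀ i, 1 ≤ i → ξ i ω = 1 ∨ ξ i ω = -1 := by
  rw [ae_all_iff]
  intro i
  by_cases hi : 1 ≤ i
  · have hm1 : MeasurableSet {ω | ξ i ω = 1} := hξ.measurable i hi (measurableSet_singleton 1)
    have hm2 : MeasurableSet {ω | ξ i ω = -1} :=
      hξ.measurable i hi (measurableSet_singleton (-1))
    have hd : Disjoint {ω | ξ i ω = 1} {ω | ξ i ω = -1} := by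
      rw [Set.disjoint_left]
      intro ω h1 h2
      simp only [Set.mem_ofPred_eq] at h1 h2
      linarith
    have hu : P ({ω | ξ i ω = 1} ∪ {ω | ξ i ω = -1}) = 1 := by
      rw [measure_union hd hm2, hξ.prob_one i hi, hξ.prob_neg_one i hi]
      exact ENNReal.add_halves 1
    have := (prob_compl_eq_zero_iff (hm1.union hm2)).2 hu
    filter_upwards [measure_eq_zero_iff_ae_notMem.1 this] with ω hω _
    simpa [or_iff_not_imp_left] using hω
  · exact Eventually.of_forall fun ω h => absurd h hi

theorem IsFairSignSequence.ae_abs_eq (hξ : IsFairSignSequence P ξ) :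
    ∀ᵐ ω ∂P, ∀ i, 1 ≤ i → |ξ i ω| = 1 := by
  filter_upwards [hξ.ae_eq_one_or] with ω h i hi
  rcases h i hi with h | h <;> simp [h]

theorem IsFairSignSequence.memLp_top (hξ : IsFairSignSequence P ξ) {i : ℕ} (hi : 1 ≤ i) :
    MemLp (ξ i) ∞ P := by
  refine memLp_top_of_bound (hξ.measurable i hi).aestronglyMeasurable 1 ?_
  filter_upwards [hξ.ae_abs_eq] with ω h
  exact (h i hi).le

theorem IsFairSignSequence.integral_eq_zero (hξ : IsFairSignSequence P ξ) {i : ℕ} (hi : 1 ≤ i) :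
    ∫ ω, ξ i ω ∂P = 0 := by
  have hm1 : MeasurableSet {ω | ξ i ω = 1} := hξ.measurable i hi (measurableSet_singleton 1)
  have hm2 : MeasurableSet {ω | ξ i ω = -1} := hξ.measurable i hi (measurableSet_singleton (-1))
  have h : ξ i =ᵐ[P] fun ω => Set.indicator {ω | ξ i ω = 1} (fun _ => (1 : ℝ)) ω
      - Set.indicator {ω | ξ i ω = -1} (fun _ => (1 : ℝ)) ω := by
    filter_upwards [hξ.ae_eq_one_or] with ω hω
    rcases hω i hi with h | h <;> simp [Set.indicator, h] <;> norm_num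
  rw [integral_congr_ae h, integral_sub ((integrable_const 1).indicator hm1)
    ((integrable_const 1).indicator hm2), integral_indicator_const _ hm1,
    integral_indicator_const _ hm2]
  simp [Measure.real, hξ.prob_one i hi, hξ.prob_neg_one i hi]

theorem IsFairSignSequence.integral_mul_eq_zero (hξ : IsFairSignSequence P ξ) {k : ℕ}
    (hk : 1 ≤ k) {W : Ω → ℝ} (hW : Measurable[info ξ (k - 1)] W) :
    ∫ ω, ξ k ω * W ω ∂P = 0 := by
  have hind : Indep (⨆ i ∈ ({k - 1} : Set ℕ), MeasurableSpace.comap (ξ (i + 1)) inferInstance)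
      (⨆ i ∈ Set.Iio (k - 1), MeasurableSpace.comap (ξ (i + 1)) inferInstance) P :=
    indep_iSup_of_disjoint (fun i => (hξ.measurable (i + 1) (by omega)).comap_le)
      hξ.indep.iIndep (by simp)
  have hle : info ξ (k - 1) ≤
      ⨆ i ∈ Set.Iio (k - 1), MeasurableSpace.comap (ξ (i + 1)) inferInstance := by
    refine iSup₂_le fun i hi => ?_
    rw [Finset.mem_Icc] at hi
    have := le_biSup (fun i => MeasurableSpace.comap (ξ (i + 1)) inferInstance)
      (show i - 1 ∈ Set.Iio (k - 1) from Set.mem_Iio.2 (by omega))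
    rwa [Nat.sub_add_cancel hi.1] at this
  simp only [Set.mem_singleton_iff, iSup_iSup_eq_left, Nat.sub_add_cancel hk] at hind
  have hfun : IndepFun (ξ k) W P := by
    rw [IndepFun_iff_Indep]
    exact indep_of_indep_of_le_right hind (hW.comap_le.trans hle)
  rw [hfun.integral_fun_mul_eq_mul_integral (hξ.measurable k hk).aestronglyMeasurable
    (hW.mono (hξ.info_le _) le_rfl).aestronglyMeasurable, hξ.integral_eq_zero hk, zero_mul]

theorem integrable_of_memLp_top {f : Ω → ℝ} (hf : MemLp f ∞ P) : Integrable f P :=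
  hf.integrable le_top

theorem IsFairSignSequence.memLp_top_transform (hξ : IsFairSignSequence P ξ) {Z : ℕ → Ω → ℝ}
    (hZ : ∀ k, 1 ≤ k → MemLp (Z k) ∞ P) (n : ℕ) : MemLp (transform ξ Z n) ∞ P := by
  refine memLp_finsetSum _ fun k hk => ?_
  rw [Finset.mem_Icc] at hk
  exact memLp_top_mul (hξ.memLp_top hk.1) (hZ k hk.1)

/-- The increments of a martingale transform are orthogonal. -/
theorem IsFairSignSequence.integral_transform_sq (hξ : IsFairSignSequence P ξ) {Z : ℕ → Ω → ℝ}
    (hZm : ∀ k, 1 ≤ k → Measurable[info ξ (k - 1)] (Z k)) (hZ : ∀ k, 1 ≤ k → MemLp (Z k) ∞ P)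
    (n : ℕ) :
    ∫ ω, transform ξ Z n ω ^ 2 ∂P = ∑ k ∈ Finset.Icc 1 n, ∫ ω, Z k ω ^ 2 ∂P := by
  induction n with
  | zero => simp [transform]
  | succ n ih =>
    rw [Finset.sum_Icc_succ_top (by omega), ← ih]
    have hM := hξ.memLp_top_transform hZ n
    have hZn := hZ (n + 1) (by omega)
    have hx := hξ.memLp_top (i := n + 1) (by omega)
    have i1 := integrable_of_memLp_top (memLp_top_sq hM)
    have i2 := integrable_of_memLp_top (memLp_top_sq hZn)
    have i3 := integrable_of_memLp_top
      (memLp_top_mul hx ((memLp_top_mul hM hZn).const_mul 2))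
    have h : (fun ω => transform ξ Z (n + 1) ω ^ 2) =ᵐ[P] fun ω =>
        transform ξ Z n ω ^ 2 + ξ (n + 1) ω * (2 * (transform ξ Z n ω * Z (n + 1) ω))
          + Z (n + 1) ω ^ 2 := by
      filter_upwards [hξ.ae_abs_eq] with ω hω
      have h1 : ξ (n + 1) ω ^ 2 = 1 := by rw [← sq_abs, hω _ (by omega), one_pow]
      rw [transform_succ]
      linear_combination Z (n + 1) ω ^ 2 * h1
    rw [integral_congr_ae h, integral_add (by exact i1.add i3) i2, integral_add i1 i3,
      hξ.integral_mul_eq_zero (k := n + 1) (by omega), add_zero]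
    exact measurable_const.mul
      ((measurable_info_transform hZm n).mul (hZm (n + 1) (by omega)))

theorem IsFairSignSequence.integral_sum_sq (hξ : IsFairSignSequence P ξ) (c : ℕ → ℝ) (n : ℕ) :
    ∫ ω, (∑ i ∈ Finset.Icc 1 n, c i * ξ i ω) ^ 2 ∂P = ∑ i ∈ Finset.Icc 1 n, c i ^ 2 := by
  have := hξ.integral_transform_sq (Z := fun k _ => c k) (fun _ _ => measurable_const)
    (fun k _ => memLp_const (c k)) n
  simpa [transform, mul_comm] using this

/-- A one-sided form of Doob's maximal inequality. -/
theorem IsFairSignSequence.measure_exists_transform_lt_le (hξ : IsFairSignSequence P ξ)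
    {Z : ℕ → Ω → ℝ} (hZm : ∀ k, 1 ≤ k → Measurable[info ξ (k - 1)] (Z k))
    (hZ : ∀ k, 1 ≤ k → MemLp (Z k) ∞ P) (N : ℕ) {c : ℝ} (hc : 0 < c) :
    P {ω | ∃ n ∈ Finset.Icc 1 N, transform ξ Z n ω < -c}
      ≤ ENNReal.ofReal ((∑ k ∈ Finset.Icc 1 N, ∫ ω, Z k ω ^ 2 ∂P) / c ^ 2) := by
  classical
  -- The event that no drop occurs before time `k` is known at time `k - 1`. Multiplying the
  -- integrand by its indicator stops the transform at its first drop while keeping it a transform,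
  -- so Markov's inequality for the square at time `N` suffices.
  let A : ℕ → Set Ω := fun k => {ω | ∀ m ∈ Finset.Icc 1 (k - 1), -c ≤ transform ξ Z m ω}
  have hA : ∀ k, MeasurableSet[info ξ (k - 1)] (A k) := by
    intro k
    have : A k = ⋂ m ∈ Finset.Icc 1 (k - 1), {ω | -c ≤ transform ξ Z m ω} := by
      ext ω
      simp [A]
    rw [this]
    refine Finset.measurableSet_biInter _ fun m hm => ?_
    have h1 : Measurable[info ξ (k - 1)] (transform ξ Z m) :=
      (measurable_info_transform hZm m).mono (info_mono (Finset.mem_Icc.1 hm).2) le_rfl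
    exact h1 measurableSet_Ici
  let Z' : ℕ → Ω → ℝ := fun k => (A k).indicator (Z k)
  have hZm' : ∀ k, 1 ≤ k → Measurable[info ξ (k - 1)] (Z' k) := fun k hk =>
    (hZm k hk).indicator (hA k)
  have hZ' : ∀ k, 1 ≤ k → MemLp (Z' k) ∞ P := fun k hk =>
    (hZ k hk).indicator (hξ.info_le _ _ (hA k))
  have hstopped : ∀ ω, (∃ n ∈ Finset.Icc 1 N, transform ξ Z n ω < -c) →
      transform ξ Z' N ω < -c := by
    intro ω hω
    let n := Nat.find hω
    obtain ⟨hn, hlt⟩ := Nat.find_spec hω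
    have hmin : ∀ m, m < n → m ∈ Finset.Icc 1 N → -c ≤ transform ξ Z m ω := by
      intro m hm hmN
      by_contra hcon
      exact Nat.find_min hω hm ⟨hmN, not_le.1 hcon⟩
    rw [Finset.mem_Icc] at hn
    have : transform ξ Z' N ω = transform ξ Z n ω := by
      unfold transform
      rw [← Finset.sum_subset (Finset.Icc_subset_Icc_right hn.2)]
      · refine Finset.sum_congr rfl fun k hk => ?_
        rw [Finset.mem_Icc] at hk
        have : ω ∈ A k := fun m hm => by
          rw [Finset.mem_Icc] at hm
          exact hmin m (show m < n by have : k ≤ n := hk.2; omega)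
            (Finset.mem_Icc.2 ⟨hm.1, by omega⟩)
        simp only [Z', Set.indicator_of_mem this]
      · intro k hk hk'
        rw [Finset.mem_Icc] at hk hk'
        have hnk : n < k := by
          by_contra hcon
          exact hk' ⟨hk.1, not_lt.1 hcon⟩
        have : ω ∉ A k := fun h =>
          absurd (h n (Finset.mem_Icc.2 ⟨hn.1, by omega⟩)) (not_le.2 hlt)
        simp only [Z', Set.indicator_of_notMem this, mul_zero]
    rw [this]
    exact hlt
  have hsub : {ω | ∃ n ∈ Finset.Icc 1 N, transform ξ Z n ω < -c}
      ⊆ {ω | c ^ 2 ≤ transform ξ Z' N ω ^ 2} := by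
    intro ω hω
    have := hstopped ω hω
    simp only [Set.mem_ofPred_eq]
    nlinarith
  refine (measure_mono hsub).trans ?_
  have hmarkov := mul_meas_ge_le_integral_of_nonneg (μ := P)
    (Eventually.of_forall fun ω => sq_nonneg (transform ξ Z' N ω))
    (integrable_of_memLp_top (memLp_top_sq (hξ.memLp_top_transform hZ' N))) (c ^ 2)
  rw [hξ.integral_transform_sq hZm' hZ'] at hmarkov
  have hle : ∑ k ∈ Finset.Icc 1 N, ∫ ω, Z' k ω ^ 2 ∂P ≤ ∑ k ∈ Finset.Icc 1 N, ∫ ω, Z k ω ^ 2 ∂P := by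
    refine Finset.sum_le_sum fun k hk => ?_
    have hk1 := (Finset.mem_Icc.1 hk).1
    refine integral_mono (integrable_of_memLp_top (memLp_top_sq (hZ' k hk1)))
      (integrable_of_memLp_top (memLp_top_sq (hZ k hk1))) fun ω => ?_
    by_cases h : ω ∈ A k
    · simp [Z', h]
    · simpa [Z', h] using sq_nonneg (Z k ω)
  rw [← ENNReal.ofReal_toReal (measure_ne_top P _)]
  refine ENNReal.ofReal_le_ofReal ?_
  rw [le_div_iff₀ (by positivity), mul_comm]
  exact hmarkov.trans hle

/-- The variance of a quadratic form in fair signs. -/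
theorem IsFairSignSequence.integral_quadratic_sq_le (hξ : IsFairSignSequence P ξ)
    (a : ℕ → ℕ → ℝ) (n : ℕ) :
    ∫ ω, (∑ i ∈ Finset.Icc 1 n, ∑ l ∈ Finset.Icc 1 n, a i l * (ξ i ω * ξ l ω)
        - ∑ i ∈ Finset.Icc 1 n, a i i) ^ 2 ∂P
      ≤ 2 * ∑ i ∈ Finset.Icc 1 n, ∑ l ∈ Finset.Icc 1 n, a i l ^ 2 := by
  -- Because `ξ_i^2 = 1`, the diagonal is exactly the subtracted trace. Grouping the off-diagonal
  -- terms by their larger index `l` exhibits the centred form as a martingale transform.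
  let Z : ℕ → Ω → ℝ := fun l ω => ∑ i ∈ Finset.Icc 1 (l - 1), (a i l + a l i) * ξ i ω
  have hZm : ∀ k, 1 ≤ k → Measurable[info ξ (k - 1)] (Z k) := fun k hk =>
    Finset.measurable_fun_sum _ fun i hi =>
      measurable_const.mul (measurable_info (Finset.mem_Icc.1 hi).1 (Finset.mem_Icc.1 hi).2)
  have hZ : ∀ k, 1 ≤ k → MemLp (Z k) ∞ P := fun k hk =>
    memLp_finsetSum _ fun i hi => (hξ.memLp_top (Finset.mem_Icc.1 hi).1).const_mul _
  have hsplit : ∀ (f : ℕ → ℕ → ℝ) (n : ℕ),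
      ∑ i ∈ Finset.Icc 1 (n + 1), ∑ l ∈ Finset.Icc 1 (n + 1), f i l
      = ∑ i ∈ Finset.Icc 1 n, ∑ l ∈ Finset.Icc 1 n, f i l
        + ∑ i ∈ Finset.Icc 1 n, (f i (n + 1) + f (n + 1) i) + f (n + 1) (n + 1) := by
    intro f n
    rw [Finset.sum_Icc_succ_top (by omega), Finset.sum_Icc_succ_top (by omega)]
    simp only [Finset.sum_Icc_succ_top (show 1 ≤ n + 1 by omega), Finset.sum_add_distrib]
    ring
  have hid : ∀ᵐ ω ∂P, (∑ i ∈ Finset.Icc 1 n, ∑ l ∈ Finset.Icc 1 n, a i l * (ξ i ω * ξ l ω)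
        - ∑ i ∈ Finset.Icc 1 n, a i i) ^ 2 = transform ξ Z n ω ^ 2 := by
    filter_upwards [hξ.ae_abs_eq] with ω hω
    congr 1
    induction n with
    | zero => simp [transform]
    | succ n ih =>
      have h1 : ξ (n + 1) ω ^ 2 = 1 := by rw [← sq_abs, hω _ (by omega), one_pow]
      rw [transform_succ, ← ih, hsplit, Finset.sum_Icc_succ_top (by omega)]
      simp only [Z, Nat.add_sub_cancel, Finset.mul_sum]
      have h2 : ∑ i ∈ Finset.Icc 1 n, (a i (n + 1) * (ξ i ω * ξ (n + 1) ω)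
          + a (n + 1) i * (ξ (n + 1) ω * ξ i ω))
          = ∑ i ∈ Finset.Icc 1 n, ξ (n + 1) ω * ((a i (n + 1) + a (n + 1) i) * ξ i ω) :=
        Finset.sum_congr rfl fun i _ => by ring
      rw [h2]
      linear_combination a (n + 1) (n + 1) * h1
  rw [integral_congr_ae hid, hξ.integral_transform_sq hZm hZ]
  simp only [Z, hξ.integral_sum_sq]
  clear hid
  induction n with
  | zero => simp
  | succ n ih =>
    rw [Finset.sum_Icc_succ_top (by omega), hsplit]
    have h3 : ∑ i ∈ Finset.Icc 1 n, (a i (n + 1) + a (n + 1) i) ^ 2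
        ≤ 2 * ∑ i ∈ Finset.Icc 1 n, (a i (n + 1) ^ 2 + a (n + 1) i ^ 2) := by
      rw [Finset.mul_sum]
      exact Finset.sum_le_sum fun i _ => by nlinarith [sq_nonneg (a i (n + 1) - a (n + 1) i)]
    have h4 := sq_nonneg (a (n + 1) (n + 1))
    simp only [Nat.add_sub_cancel]
    linarith

end Signs

/-- By monotone convergence the series of the `F j ^ 2` has finite expectation, hence converges
almost surely and its terms vanish. -/
theorem ae_tendsto_zero_of_summable_integral_sq {Ω : Type*} [MeasurableSpace Ω] {P : Measure Ω}
    {F : ℕ → Ω → ℝ} (hF : ∀ j, Integrable (fun ω => F j ω ^ 2) P) {b : ℕ → ℝ}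
    (hb : ∀ j, ∫ ω, F j ω ^ 2 ∂P ≤ b j) (hs : Summable b) :
    ∀ᵐ ω ∂P, Tendsto (fun j => F j ω) atTop (𝓝 0) := by
  have hb0 : ∀ j, 0 ≤ b j := fun j => (integral_nonneg fun ω => sq_nonneg _).trans (hb j)
  have hm : ∀ j, AEMeasurable (fun ω => ENNReal.ofReal (F j ω ^ 2)) P := fun j =>
    (hF j).aemeasurable.ennreal_ofReal
  have hfin : ∫⁻ ω, ∑' j, ENNReal.ofReal (F j ω ^ 2) ∂P ≠ ∞ := by
    rw [lintegral_tsum hm]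
    refine ne_top_of_le_ne_top (b := ∑' j, ENNReal.ofReal (b j)) ?_ (ENNReal.tsum_le_tsum fun j => ?_)
    · rw [← ENNReal.ofReal_tsum_of_nonneg hb0 hs]
      exact ENNReal.ofReal_ne_top
    · rw [← ofReal_integral_eq_lintegral_ofReal (hF j) (Eventually.of_forall fun ω => sq_nonneg _)]
      exact ENNReal.ofReal_le_ofReal (hb j)
  filter_upwards [ae_lt_top' (AEMeasurable.tsum hm) hfin] with ω hω
  have h1 := ENNReal.tendsto_atTop_zero_of_tsum_ne_top hω.ne
  have h2 := (ENNReal.tendsto_toReal ENNReal.zero_ne_top).comp h1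
  simp only [Function.comp_def, ENNReal.toReal_ofReal (sq_nonneg _), ENNReal.toReal_zero] at h2
  have h3 := h2.sqrt
  simp only [Real.sqrt_sq_eq_abs, Real.sqrt_zero] at h3
  exact (tendsto_zero_iff_abs_tendsto_zero _).2 h3

/-! ### The moving averages `Y_n` and the first three sums -/

section MovingAverage

variable {Ω : Type*} {ξ : ℕ → Ω → ℝ} {H σ : ℝ}

/-- The coefficients `j_n(i)`, extended by zero to `i ≥ n`. -/
noncomputable def jExt (H σ : ℝ) (n i : ℕ) : ℝ := if i < n then jCoef H σ n i else 0

theorem sum_jExt_mul {k n : ℕ} (hkn : k ≤ n + 1) (f : ℕ → ℝ) :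
    ∑ i ∈ Finset.Icc 1 n, jExt H σ k i * f i = ∑ i ∈ Finset.Ico 1 k, jCoef H σ k i * f i := by
  have hsub : Finset.Ico 1 k ⊆ Finset.Icc 1 n := fun i hi => by
    rw [Finset.mem_Ico] at hi
    exact Finset.mem_Icc.2 ⟨hi.1, by omega⟩
  rw [← Finset.sum_subset hsub]
  · refine Finset.sum_congr rfl fun i hi => ?_
    rw [jExt, if_pos (Finset.mem_Ico.1 hi).2]
  · intro i hi hi'
    rw [Finset.mem_Ico] at hi'
    rw [jExt, if_neg fun h => hi' ⟨(Finset.mem_Icc.1 hi).1, h⟩, zero_mul]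

theorem yProc_eq_sum {k n : ℕ} (hkn : k ≤ n + 1) (ω : Ω) :
    yProc H σ ξ k ω = ∑ i ∈ Finset.Icc 1 n, jExt H σ k i * ξ i ω :=
  (sum_jExt_mul hkn fun i => ξ i ω).symm

theorem jExt_nonneg (hH : 1 / 2 < H) (hH1 : H < 1) (hσ : 0 < σ) {n i : ℕ} (hi : 1 ≤ i) :
    0 ≤ jExt H σ n i := by
  unfold jExt
  split_ifs with h
  · exact jCoef_nonneg hH hH1 hσ hi h
  · exact le_rfl

theorem measurable_info_yProc {k n : ℕ} (h : k ≤ n + 1) :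
    Measurable[info ξ n] (yProc H σ ξ k) := by
  refine Finset.measurable_fun_sum _ fun i hi => ?_
  rw [Finset.mem_Ico] at hi
  exact measurable_const.mul (measurable_info hi.1 (by omega))

variable [MeasurableSpace Ω] {P : Measure Ω}

theorem integral_const_mul_sq_le {g K C : ℝ} (hg0 : 0 ≤ g) (hgK : g ≤ K) {f : Ω → ℝ}
    (hf : ∫ ω, f ω ^ 2 ∂P ≤ C) : ∫ ω, (g * f ω) ^ 2 ∂P ≤ K ^ 2 * C := by
  simp only [mul_pow, integral_const_mul]
  exact mul_le_mul (pow_le_pow_left₀ hg0 hgK 2) hf (integral_nonneg fun ω => sq_nonneg _)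
    (by positivity)

variable [IsProbabilityMeasure P]

theorem IsFairSignSequence.memLp_top_sum (hξ : IsFairSignSequence P ξ) (c : ℕ → ℝ) (k : ℕ) :
    MemLp (fun ω => ∑ i ∈ Finset.Ico 1 k, c i * ξ i ω) ∞ P :=
  memLp_finsetSum _ fun _ hi => (hξ.memLp_top (Finset.mem_Ico.1 hi).1).const_mul _

theorem IsFairSignSequence.memLp_top_yProc (hξ : IsFairSignSequence P ξ) (k : ℕ) :
    MemLp (yProc H σ ξ k) ∞ P :=
  hξ.memLp_top_sum _ k

theorem IsFairSignSequence.integral_sum_Ico_sq (hξ : IsFairSignSequence P ξ) (c : ℕ → ℝ) (k : ℕ) :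
    ∫ ω, (∑ i ∈ Finset.Ico 1 k, c i * ξ i ω) ^ 2 ∂P = ∑ i ∈ Finset.Ico 1 k, c i ^ 2 := by
  rcases k with _ | k
  · simp
  · exact hξ.integral_sum_sq c k

theorem IsFairSignSequence.exists_abs_yProc_le (hξ : IsFairSignSequence P ξ) (hH : 1 / 2 < H)
    (hH1 : H < 1) (hσ : 0 < σ) :
    ∃ C : ℝ, 0 < C ∧ ∀ᵐ ω ∂P, ∀ k, |yProc H σ ξ k ω| ≤ C * (k : ℝ) ^ (H - 1 / 2) := by
  obtain ⟨C, hC, h⟩ := exists_sum_jCoef_le hH hH1 hσ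
  refine ⟨C, hC, ?_⟩
  filter_upwards [hξ.ae_abs_eq] with ω hω k
  refine (Finset.abs_sum_le_sum_abs _ _).trans (le_trans (le_of_eq ?_) (h k))
  refine Finset.sum_congr rfl fun i hi => ?_
  rw [Finset.mem_Ico] at hi
  rw [abs_mul, hω i hi.1, mul_one, abs_of_nonneg (jCoef_nonneg hH hH1 hσ hi.1 hi.2)]

theorem IsFairSignSequence.exists_abs_xProc_le (hξ : IsFairSignSequence P ξ) (hH : 1 / 2 < H)
    (hH1 : H < 1) (hσ : 0 < σ) :
    ∃ C : ℝ, 0 < C ∧ ∀ᵐ ω ∂P, ∀ k, 1 ≤ k → |xProc H σ ξ k ω| ≤ C * (k : ℝ) ^ (H - 1 / 2) := by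
  obtain ⟨C, hC, h⟩ := hξ.exists_abs_yProc_le hH hH1 hσ
  have hK := coefBound_pos hH hH1 hσ
  refine ⟨C + coefBound H σ, by positivity, ?_⟩
  filter_upwards [h, hξ.ae_abs_eq] with ω hω hω' k hk
  have h1 : (1 : ℝ) ≤ (k : ℝ) ^ (H - 1 / 2) :=
    Real.one_le_rpow (by exact_mod_cast hk) (by linarith)
  unfold xProc
  refine (abs_add_le _ _).trans ?_
  rw [abs_mul, hω' k hk, mul_one, abs_of_nonneg (gCoef_nonneg hH hH1 hσ k), add_mul]
  refine add_le_add (hω k) ((gCoef_le hH hH1 hσ k).trans ?_)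
  exact le_mul_of_one_le_right hK.le h1

theorem IsFairSignSequence.exists_isThetaBound_theta1 (hξ : IsFairSignSequence P ξ)
    (hH : 1 / 2 < H) (hH1 : H < 1) (hσ : 0 < σ) :
    ∃ C, IsThetaBound P H (theta1 H σ ξ) C := by
  have hK := coefBound_pos hH hH1 hσ
  refine ⟨coefBound H σ * coefBound H σ, by positivity, fun N hN n hn => ?_⟩
  filter_upwards [hξ.ae_abs_eq] with ω hω
  have hN1 : (1 : ℝ) ≤ (N : ℝ) ^ (H - 1 / 2) :=
    Real.one_le_rpow (by exact_mod_cast hN) (by linarith)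
  rw [Finset.mem_Icc] at hn
  have hg := gCoef_le hH hH1 hσ
  have hg0 := gCoef_nonneg hH hH1 hσ
  refine le_trans ?_ (le_mul_of_one_le_right (by positivity) hN1)
  -- Nothing is assumed about `ξ 0`; at `n = 1` the convention `g_0 = 0` removes it.
  rcases Nat.eq_or_lt_of_le hn.1 with rfl | h1
  · simp only [theta1, le_refl, Nat.sub_eq_zero_of_le, gCoef, if_true, zero_mul, abs_zero]
    positivity
  · rw [theta1, abs_mul, abs_mul, hω n hn.1, hω (n - 1) (by omega), mul_one, mul_one,
      abs_of_nonneg (mul_nonneg (hg0 _) (hg0 _))]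
    exact mul_le_mul (hg _) (hg _) (hg0 _) hK.le

theorem IsFairSignSequence.exists_isThetaBound_theta2 (hξ : IsFairSignSequence P ξ)
    (hH : 1 / 2 < H) (hH1 : H < 1) (hσ : 0 < σ) :
    ∃ C, IsThetaBound P H (theta2 H σ ξ) C := by
  have hK := coefBound_pos hH hH1 hσ
  obtain ⟨C, hC, h⟩ := hξ.exists_abs_yProc_le hH hH1 hσ
  refine ⟨coefBound H σ * C, by positivity, fun N hN n hn => ?_⟩
  filter_upwards [hξ.ae_abs_eq, h] with ω hω hY
  rw [Finset.mem_Icc] at hn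
  rw [theta2, abs_mul, abs_mul, hω n hn.1, mul_one, abs_of_nonneg (gCoef_nonneg hH hH1 hσ n),
    mul_assoc]
  refine mul_le_mul (gCoef_le hH hH1 hσ n) ((hY _).trans ?_) (abs_nonneg _) hK.le
  refine mul_le_mul_of_nonneg_left (Real.rpow_le_rpow (by positivity) ?_ (by linarith)) hC.le
  exact_mod_cast (by omega : n - 1 ≤ N)

/-- A maximal inequality for transforms with uniformly bounded second moments. -/
theorem IsFairSignSequence.measure_exists_transform_lt_le_of_le (hξ : IsFairSignSequence P ξ)
    {Z : ℕ → Ω → ℝ} (hZm : ∀ k, 1 ≤ k → Measurable[info ξ (k - 1)] (Z k))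
    (hZ : ∀ k, 1 ≤ k → MemLp (Z k) ∞ P) {D : ℝ} (hD : ∀ k, 1 ≤ k → ∫ ω, Z k ω ^ 2 ∂P ≤ D)
    (N : ℕ) {c : ℝ} (hc : 0 < c) :
    P {ω | ∃ n ∈ Finset.Icc 1 N, transform ξ Z n ω < -c} ≤ ENNReal.ofReal (D * N / c ^ 2) := by
  refine (hξ.measure_exists_transform_lt_le hZm hZ N hc).trans (ENNReal.ofReal_le_ofReal ?_)
  gcongr
  calc _ ≤ ∑ k ∈ Finset.Icc 1 N, D :=
        Finset.sum_le_sum fun k hk => hD k (Finset.mem_Icc.1 hk).1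
    _ = D * N := by simp [mul_comm]

theorem IsFairSignSequence.exists_measure_theta1_le (hξ : IsFairSignSequence P ξ)
    (hH : 1 / 2 < H) (hH1 : H < 1) (hσ : 0 < σ) :
    ∃ D : ℝ, ∀ (N : ℕ) (c : ℝ), 0 < c →
      P {ω | ∃ n ∈ Finset.Icc 1 N, partialSum (theta1 H σ ξ) n ω < -c}
        ≤ ENNReal.ofReal (D * N / c ^ 2) := by
  have hg := gCoef_le hH hH1 hσ
  have hg0 := gCoef_nonneg hH hH1 hσ
  have hK := coefBound_pos hH hH1 hσ
  let Z : ℕ → Ω → ℝ := fun k ω => gCoef H σ k * (gCoef H σ (k - 1) * ξ (k - 1) ω)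
  -- The value `ξ 0` need not be measurable, so the first integrand is treated separately, using
  -- `g_0 = 0`.
  have hZ1 : Z 1 = fun _ => 0 := by
    funext ω
    simp [Z, gCoef]
  have hZm : ∀ k, 1 ≤ k → Measurable[info ξ (k - 1)] (Z k) := by
    intro k hk
    rcases Nat.eq_or_lt_of_le hk with rfl | h1
    · rw [hZ1]
      exact measurable_const
    · exact measurable_const.mul (measurable_const.mul (measurable_info (by omega) le_rfl))
  have hZ : ∀ k, 1 ≤ k → MemLp (Z k) ∞ P := by
    intro k hk
    rcases Nat.eq_or_lt_of_le hk with rfl | h1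
    · rw [hZ1]
      exact memLp_const 0
    · exact ((hξ.memLp_top (by omega)).const_mul _).const_mul _
  refine ⟨coefBound H σ ^ 2 * coefBound H σ ^ 2, fun N c hc => ?_⟩
  have hsum : partialSum (theta1 H σ ξ) = transform ξ Z := by
    funext n ω
    exact Finset.sum_congr rfl fun k _ => by
      simp only [theta1, Z]
      ring
  rw [hsum]
  refine hξ.measure_exists_transform_lt_le_of_le hZm hZ (fun k hk => ?_) N hc
  refine integral_const_mul_sq_le (hg0 k) (hg k) ?_
  rcases Nat.eq_or_lt_of_le hk with rfl | h1
  · simp only [gCoef, le_refl, Nat.sub_eq_zero_of_le, if_true, zero_mul]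
    simp only [ne_eq, OfNat.ofNat_ne_zero, not_false_eq_true, zero_pow, integral_zero]
    positivity
  · have : (fun ω => (gCoef H σ (k - 1) * ξ (k - 1) ω) ^ 2)
        =ᵐ[P] fun _ => gCoef H σ (k - 1) ^ 2 := by
      filter_upwards [hξ.ae_abs_eq] with ω hω
      rw [mul_pow, ← sq_abs (ξ (k - 1) ω), hω _ (by omega), one_pow, mul_one]
    rw [integral_congr_ae this]
    simpa using pow_le_pow_left₀ (hg0 (k - 1)) (hg (k - 1)) 2

theorem IsFairSignSequence.exists_measure_theta2_le (hξ : IsFairSignSequence P ξ)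
    (hH : 1 / 2 < H) (hH1 : H < 1) (hσ : 0 < σ) :
    ∃ D : ℝ, ∀ (N : ℕ) (c : ℝ), 0 < c →
      P {ω | ∃ n ∈ Finset.Icc 1 N, partialSum (theta2 H σ ξ) n ω < -c}
        ≤ ENNReal.ofReal (D * N / c ^ 2) := by
  obtain ⟨C, -, hC⟩ := exists_sum_jCoef_sq_le hH hH1 hσ
  let Z : ℕ → Ω → ℝ := fun k ω => gCoef H σ k * yProc H σ ξ (k - 1) ω
  refine ⟨coefBound H σ ^ 2 * C, fun N c hc => ?_⟩
  have hsum : partialSum (theta2 H σ ξ) = transform ξ Z := by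
    funext n ω
    exact Finset.sum_congr rfl fun k _ => by
      simp only [theta2, Z]
      ring
  rw [hsum]
  refine hξ.measure_exists_transform_lt_le_of_le
    (fun k _ => measurable_const.mul (measurable_info_yProc (by omega)))
    (fun k _ => (hξ.memLp_top_yProc _).const_mul _) (fun k _ => ?_) N hc
  refine integral_const_mul_sq_le (gCoef_nonneg hH hH1 hσ k) (gCoef_le hH hH1 hσ k) ?_
  exact (hξ.integral_sum_Ico_sq _ _).trans_le (hC _)

/-- `Y_k` contains `ξ_{k-1}`, so `θ^{(3)}_k` is not a martingale increment. Its diagonal part is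
`g_{k-1} j_k(k-1) ξ_{k-1}^2 ≥ 0`; discarding it only lowers the sum and leaves a transform indexed
by `m = k - 1`, hence the shift by one below. -/
theorem IsFairSignSequence.exists_measure_theta3_le (hξ : IsFairSignSequence P ξ)
    (hH : 1 / 2 < H) (hH1 : H < 1) (hσ : 0 < σ) :
    ∃ D : ℝ, ∀ (N : ℕ) (c : ℝ), 0 < c →
      P {ω | ∃ n ∈ Finset.Icc 1 N, partialSum (theta3 H σ ξ) n ω < -c}
        ≤ ENNReal.ofReal (D * N / c ^ 2) := by
  obtain ⟨C, -, hC⟩ := exists_sum_jCoef_sq_le hH hH1 hσ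
  let Z : ℕ → Ω → ℝ := fun m ω =>
    gCoef H σ m * ∑ i ∈ Finset.Ico 1 m, jCoef H σ (m + 1) i * ξ i ω
  refine ⟨coefBound H σ ^ 2 * C, fun N c hc => ?_⟩
  have hZm : ∀ k, 1 ≤ k → Measurable[info ξ (k - 1)] (Z k) := fun k hk =>
    measurable_const.mul (Finset.measurable_fun_sum _ fun i hi => by
      rw [Finset.mem_Ico] at hi
      exact measurable_const.mul (measurable_info hi.1 (by omega)))
  have hle : ∀ᵐ ω ∂P, ∀ n, transform ξ Z n ω ≤ partialSum (theta3 H σ ξ) (n + 1) ω := by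
    filter_upwards [hξ.ae_abs_eq] with ω hω n
    induction n with
    | zero => simp [transform, partialSum, theta3, gCoef]
    | succ n ih =>
      rw [transform_succ, partialSum, Finset.sum_Icc_succ_top (by omega)]
      refine add_le_add ih ?_
      have h1 : ξ (n + 1) ω ^ 2 = 1 := by rw [← sq_abs, hω _ (by omega), one_pow]
      have h2 := mul_nonneg (gCoef_nonneg hH hH1 hσ (n + 1))
        (jCoef_nonneg hH hH1 hσ (n := n + 1 + 1) (i := n + 1) (by omega) (by omega))
      simp only [theta3, Z, yProc, Nat.add_sub_cancel]
      rw [Finset.sum_Ico_succ_top (show 1 ≤ n + 1 by omega)]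
      linear_combination h2 - gCoef H σ (n + 1) * jCoef H σ (n + 1 + 1) (n + 1) * h1
  refine le_trans (measure_mono_ae ?_) (hξ.measure_exists_transform_lt_le_of_le hZm
    (fun k _ => (hξ.memLp_top_sum _ _).const_mul _) (D := coefBound H σ ^ 2 * C) (fun k _ => ?_) N hc)
  · filter_upwards [hle] with ω hω
    rintro ⟨n, hn, hlt⟩
    rw [Finset.mem_Icc] at hn
    have hω' := hω (n - 1)
    rw [Nat.sub_add_cancel hn.1] at hω'
    refine ⟨n - 1, Finset.mem_Icc.2 ⟨?_, by omega⟩, hω'.trans_lt hlt⟩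
    -- For `n = 1` the dominated transform is the empty sum, so a drop below `-c` is impossible.
    by_contra hcon
    rw [show n - 1 = 0 by omega] at hω'
    simp only [transform, Finset.Icc_eq_empty_of_lt, zero_lt_one, Finset.sum_empty] at hω'
    linarith
  · refine integral_const_mul_sq_le (gCoef_nonneg hH hH1 hσ k) (gCoef_le hH hH1 hσ k) ?_
    rw [hξ.integral_sum_Ico_sq]
    refine le_trans ?_ (hC (k + 1))
    exact Finset.sum_le_sum_of_subset_of_nonneg
      (Finset.Ico_subset_Ico_right (Nat.le_succ k)) fun i _ _ => sq_nonneg _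

end MovingAverage

/-! ### The law of large numbers for `∑ Y_{k-1} Y_k` -/

section LagSums

variable {H σ : ℝ}

/-- The covariance of `Y_k` and `Y_l`. -/
noncomputable def covY (H σ : ℝ) (k l : ℕ) : ℝ :=
  ∑ i ∈ Finset.Ico 1 k, jCoef H σ k i * jExt H σ l i

theorem covY_eq_sum {k l n : ℕ} (hk : k ≤ n + 1) :
    covY H σ k l = ∑ i ∈ Finset.Icc 1 n, jExt H σ k i * jExt H σ l i :=
  (sum_jExt_mul hk _).symm

theorem covY_comm (k l : ℕ) : covY H σ k l = covY H σ l k := by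
  rw [covY_eq_sum (n := max k l) (by omega), covY_eq_sum (k := l) (n := max k l) (by omega)]
  exact Finset.sum_congr rfl fun i _ => mul_comm _ _

theorem covY_nonneg (hH : 1 / 2 < H) (hH1 : H < 1) (hσ : 0 < σ) (k l : ℕ) :
    0 ≤ covY H σ k l :=
  Finset.sum_nonneg fun i hi => by
    rw [Finset.mem_Ico] at hi
    exact mul_nonneg (jCoef_nonneg hH hH1 hσ hi.1 hi.2) (jExt_nonneg hH hH1 hσ hi.1)

theorem exists_covY_self_le (hH : 1 / 2 < H) (hH1 : H < 1) (hσ : 0 < σ) :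
    ∃ C : ℝ, 0 < C ∧ ∀ k, covY H σ k k ≤ C := by
  obtain ⟨C, hC0, hC⟩ := exists_sum_jCoef_sq_le hH hH1 hσ
  refine ⟨C, hC0, fun k => le_trans (le_of_eq ?_) (hC k)⟩
  refine Finset.sum_congr rfl fun i hi => ?_
  rw [jExt, if_pos (Finset.mem_Ico.1 hi).2, sq]

theorem exists_le_covY (hH : 1 / 2 < H) (hH1 : H < 1) (hσ : 0 < σ) :
    ∃ c : ℝ, 0 < c ∧ ∀ k, 5 ≤ k → c ≤ covY H σ (k - 1) k := by
  have hκ := kernelConst_pos hH hH1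
  refine ⟨(σ * kernelConst H * (4 : ℝ) ^ (H - 3 / 2)) * (σ * kernelConst H * (4 : ℝ) ^ (H - 3 / 2)),
    by positivity, fun k hk => ?_⟩
  -- All summands are nonnegative, so one suffices. The index `k - 3` lies at distance `2` from `k -
  -- 1` and `3` from `k`, the range covered by `le_jCoef`, whose condition `2 ≤ i` accounts for `5 ≤
  -- k`.
  have hmem : k - 3 ∈ Finset.Ico 1 (k - 1) := Finset.mem_Ico.2 (by omega)
  refine le_trans ?_ (Finset.single_le_sum (f := fun i => jCoef H σ (k - 1) i * jExt H σ k i)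
    (fun i hi => ?_) hmem)
  · simp only [jExt, if_pos (show k - 3 < k by omega)]
    have h1 := le_jCoef hH hH1 hσ (n := k - 1) (i := k - 3) (by omega) (by omega) (by omega)
    have h2 := le_jCoef hH hH1 hσ (n := k) (i := k - 3) (by omega) (by omega) (by omega)
    exact mul_le_mul h1 h2 (by positivity) (le_trans (by positivity) h1)
  · rw [Finset.mem_Ico] at hi
    exact mul_nonneg (jCoef_nonneg hH hH1 hσ hi.1 hi.2) (jExt_nonneg hH hH1 hσ hi.1)

/-- A symmetric bound depending on `k` and `l` only through `k - l` and a common horizon `n`; double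
sums then reduce to a convergent series over the integers. -/
theorem exists_covY_le (hH : 1 / 2 < H) (hH1 : H < 1) (hσ : 0 < σ) :
    ∃ C : ℝ, 0 < C ∧ ∀ k l n : ℕ, k ≤ n → l ≤ n →
      covY H σ k l ≤ C * (n : ℝ) ^ (H - 1 / 2) * (|(((k : ℤ) - l : ℤ) : ℝ)| + 1) ^ (H - 3 / 2) := by
  obtain ⟨C, hC0, hC⟩ := exists_sum_jCoef_mul_jCoef_le hH hH1 hσ
  refine ⟨C, hC0, ?_⟩
  have key : ∀ k l n : ℕ, k ≤ l → l ≤ n →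
      covY H σ k l ≤ C * (n : ℝ) ^ (H - 1 / 2) * (|(((k : ℤ) - l : ℤ) : ℝ)| + 1) ^ (H - 3 / 2) := by
    intro k l n hkl hln
    have hkl' : (k : ℝ) ≤ l := by exact_mod_cast hkl
    have h1 : covY H σ k l = ∑ i ∈ Finset.Ico 1 k, jCoef H σ k i * jCoef H σ l i :=
      Finset.sum_congr rfl fun i hi => by
        rw [jExt, if_pos ((Finset.mem_Ico.1 hi).2.trans_le hkl)]
    have h2 : |(((k : ℤ) - l : ℤ) : ℝ)| + 1 = ((l - k + 1 : ℕ) : ℝ) := by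
      push_cast [Nat.cast_sub hkl]
      rw [abs_of_nonpos (by linarith)]
      ring
    rw [h1, h2]
    refine (hC k l hkl).trans ?_
    refine mul_le_mul_of_nonneg_right (mul_le_mul_of_nonneg_left ?_ hC0.le) (by positivity)
    exact Real.rpow_le_rpow (by positivity) (by exact_mod_cast hln) (by linarith)
  intro k l n hk hl
  rcases le_total k l with h | h
  · exact key k l n h hl
  · have := key l k n h hk
    rw [covY_comm, show |(((k : ℤ) - l : ℤ) : ℝ)| = |(((l : ℤ) - k : ℤ) : ℝ)| by
      push_cast
      exact abs_sub_comm _ _]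
    exact this

theorem summable_abs_int_add_one_rpow {r : ℝ} (hr : r < -1) :
    Summable fun m : ℤ => (|(m : ℝ)| + 1) ^ r := by
  have h : Summable fun m : ℕ => ((m : ℝ) + 1) ^ r := by
    have := (summable_nat_add_iff 1).2 (Real.summable_nat_rpow.2 hr)
    simpa using this
  refine Summable.of_nat_of_neg ?_ ?_ <;> simpa using h

/-- The squared Frobenius norm of a sum of rank one matrices. -/
theorem sum_sq_sum_mul_eq (s t : Finset ℕ) (u v : ℕ → ℕ → ℝ) :
    ∑ i ∈ s, ∑ l ∈ s, (∑ k ∈ t, u k i * v k l) ^ 2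
      = ∑ k ∈ t, ∑ k' ∈ t, (∑ i ∈ s, u k i * u k' i) * ∑ l ∈ s, v k l * v k' l := by
  have hcomm : ∀ f : ℕ → ℕ → ℕ → ℕ → ℝ, ∑ i ∈ s, ∑ l ∈ s, ∑ k ∈ t, ∑ k' ∈ t, f i l k k'
      = ∑ k ∈ t, ∑ k' ∈ t, ∑ i ∈ s, ∑ l ∈ s, f i l k k' := fun f =>
    calc ∑ i ∈ s, ∑ l ∈ s, ∑ k ∈ t, ∑ k' ∈ t, f i l k k'
        = ∑ i ∈ s, ∑ k ∈ t, ∑ l ∈ s, ∑ k' ∈ t, f i l k k' :=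
          Finset.sum_congr rfl fun _ _ => Finset.sum_comm
      _ = ∑ k ∈ t, ∑ i ∈ s, ∑ l ∈ s, ∑ k' ∈ t, f i l k k' := Finset.sum_comm
      _ = ∑ k ∈ t, ∑ i ∈ s, ∑ k' ∈ t, ∑ l ∈ s, f i l k k' :=
          Finset.sum_congr rfl fun _ _ => Finset.sum_congr rfl fun _ _ => Finset.sum_comm
      _ = _ := Finset.sum_congr rfl fun _ _ => Finset.sum_comm
  simp only [sq, Finset.sum_mul_sum]
  rw [hcomm]
  exact Finset.sum_congr rfl fun _ _ => Finset.sum_congr rfl fun _ _ =>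
    Finset.sum_congr rfl fun _ _ => Finset.sum_congr rfl fun _ _ => by ring

/-! ### Lag sums as quadratic forms: mean, variance and oscillation. -/

variable {Ω : Type*} {ξ : ℕ → Ω → ℝ}

/-- The sum `∑_{k=1}^n Y_{k-s} Y_{k-t}`. -/
noncomputable def lagSum (H σ : ℝ) (ξ : ℕ → Ω → ℝ) (s t n : ℕ) (ω : Ω) : ℝ :=
  ∑ k ∈ Finset.Icc 1 n, yProc H σ ξ (k - s) ω * yProc H σ ξ (k - t) ω

/-- The mean of `lagSum`. -/
noncomputable def lagMean (H σ : ℝ) (s t n : ℕ) : ℝ :=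
  ∑ k ∈ Finset.Icc 1 n, covY H σ (k - s) (k - t)

theorem lagSum_eq_quadratic (s t n : ℕ) (ω : Ω) :
    lagSum H σ ξ s t n ω = ∑ i ∈ Finset.Icc 1 n, ∑ l ∈ Finset.Icc 1 n,
      (∑ k ∈ Finset.Icc 1 n, jExt H σ (k - s) i * jExt H σ (k - t) l) * (ξ i ω * ξ l ω) := by
  have h : lagSum H σ ξ s t n ω = ∑ k ∈ Finset.Icc 1 n, ∑ i ∈ Finset.Icc 1 n,
      ∑ l ∈ Finset.Icc 1 n, jExt H σ (k - s) i * jExt H σ (k - t) l * (ξ i ω * ξ l ω) := by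
    refine Finset.sum_congr rfl fun k hk => ?_
    rw [Finset.mem_Icc] at hk
    rw [yProc_eq_sum (n := n) (by omega), yProc_eq_sum (k := k - t) (n := n) (by omega),
      Finset.sum_mul_sum]
    exact Finset.sum_congr rfl fun _ _ => Finset.sum_congr rfl fun _ _ => by ring
  rw [h, Finset.sum_comm]
  refine Finset.sum_congr rfl fun i _ => ?_
  rw [Finset.sum_comm]
  exact Finset.sum_congr rfl fun l _ => (Finset.sum_mul _ _ _).symm

theorem lagMean_eq_trace (s t n : ℕ) :
    lagMean H σ s t n = ∑ i ∈ Finset.Icc 1 n,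
      ∑ k ∈ Finset.Icc 1 n, jExt H σ (k - s) i * jExt H σ (k - t) i := by
  rw [Finset.sum_comm]
  refine Finset.sum_congr rfl fun k hk => covY_eq_sum ?_
  rw [Finset.mem_Icc] at hk
  omega

/-- Termwise `-xy ≤ (x^2 + y^2) / 2`. The cross sum is not monotone, but the sums of squares are, so
its decrease within a block `[a, b]` is controlled by values at the endpoints alone. -/
theorem lagSum_sub_le {a n b : ℕ} (han : a ≤ n) (hnb : n ≤ b) (ω : Ω) :
    lagSum H σ ξ 1 0 a ω - lagSum H σ ξ 1 0 n ω
      ≤ ((lagSum H σ ξ 1 1 b ω - lagSum H σ ξ 1 1 a ω)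
        + (lagSum H σ ξ 0 0 b ω - lagSum H σ ξ 0 0 a ω)) / 2 := by
  have hstep : ∀ m, a ≤ m → lagSum H σ ξ 1 0 a ω - lagSum H σ ξ 1 0 m ω
      ≤ ((lagSum H σ ξ 1 1 m ω - lagSum H σ ξ 1 1 a ω)
        + (lagSum H σ ξ 0 0 m ω - lagSum H σ ξ 0 0 a ω)) / 2 := by
    intro m hm
    induction m, hm using Nat.le_induction with
    | base => simp
    | succ m _ ih =>
      simp only [lagSum, Finset.sum_Icc_succ_top (show 1 ≤ m + 1 by omega)] at ih ⊢
      nlinarith [sq_nonneg (yProc H σ ξ (m + 1 - 1) ω + yProc H σ ξ (m + 1 - 0) ω)]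
  have hmono : ∀ s, lagSum H σ ξ s s n ω ≤ lagSum H σ ξ s s b ω := fun s =>
    Finset.sum_le_sum_of_subset_of_nonneg (Finset.Icc_subset_Icc_right hnb)
      fun k _ _ => mul_self_nonneg _
  have h1 := hstep n han
  have h2 := hmono 0
  have h3 := hmono 1
  linarith

variable [MeasurableSpace Ω] {P : Measure Ω} [IsProbabilityMeasure P]

theorem IsFairSignSequence.memLp_top_lagSum (hξ : IsFairSignSequence P ξ) (s t n : ℕ) :
    MemLp (lagSum H σ ξ s t n) ∞ P :=
  memLp_finsetSum _ fun _ _ => memLp_top_mul (hξ.memLp_top_yProc _) (hξ.memLp_top_yProc _)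

/-- The variance is at most twice the squared Frobenius norm of the coefficient matrix, a double sum
of products of two covariances. Each product is of order `n^{2H-1} (|k - k'| + 1)^{2H-3}`, and `2 H
- 3 < -1` makes every row sum bounded. -/
theorem IsFairSignSequence.exists_variance_lagSum_le (hξ : IsFairSignSequence P ξ)
    (hH : 1 / 2 < H) (hH1 : H < 1) (hσ : 0 < σ) :
    ∃ C : ℝ, 0 ≤ C ∧ ∀ s t n : ℕ, s ≤ 1 → t ≤ 1 → 1 ≤ n →
      ∫ ω, (lagSum H σ ξ s t n ω - lagMean H σ s t n) ^ 2 ∂P ≤ C * (n : ℝ) ^ (2 * H) := by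
  obtain ⟨C, hC0, hC⟩ := exists_covY_le hH hH1 hσ
  have hsm := summable_abs_int_add_one_rpow (r := 2 * H - 3) (by linarith)
  set Z := ∑' m : ℤ, (|(m : ℝ)| + 1) ^ (2 * H - 3) with hZ
  have hZ0 : 0 ≤ Z := tsum_nonneg fun m => by positivity
  refine ⟨2 * (C ^ 2 * Z), by positivity, fun s t n hs ht hn => ?_⟩
  have hn' : (0 : ℝ) < n := by exact_mod_cast hn
  simp only [lagSum_eq_quadratic, lagMean_eq_trace]
  refine (hξ.integral_quadratic_sq_le _ n).trans ?_
  rw [sum_sq_sum_mul_eq, mul_assoc]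
  refine mul_le_mul_of_nonneg_left ?_ zero_le_two
  have hterm : ∀ k ∈ Finset.Icc 1 n, ∀ k' ∈ Finset.Icc 1 n,
      (∑ i ∈ Finset.Icc 1 n, jExt H σ (k - s) i * jExt H σ (k' - s) i)
        * ∑ l ∈ Finset.Icc 1 n, jExt H σ (k - t) l * jExt H σ (k' - t) l
      ≤ C ^ 2 * (n : ℝ) ^ (2 * H - 1) * (|(((k : ℤ) - k' : ℤ) : ℝ)| + 1) ^ (2 * H - 3) := by
    intro k hk k' hk'
    rw [Finset.mem_Icc] at hk hk'
    rw [← covY_eq_sum (by omega), ← covY_eq_sum (by omega)]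
    have h1 := hC (k - s) (k' - s) n (by omega) (by omega)
    have h2 := hC (k - t) (k' - t) n (by omega) (by omega)
    -- No truncation occurs in the natural subtractions, because `s ≤ 1 ≤ k`.
    rw [show (((k - s : ℕ) : ℤ) - ((k' - s : ℕ) : ℤ)) = (k : ℤ) - k' by omega] at h1
    rw [show (((k - t : ℕ) : ℤ) - ((k' - t : ℕ) : ℤ)) = (k : ℤ) - k' by omega] at h2
    refine (mul_le_mul h1 h2 (covY_nonneg hH hH1 hσ _ _) (by positivity)).trans (le_of_eq ?_)
    have hx : 0 < |(((k : ℤ) - k' : ℤ) : ℝ)| + 1 := by positivity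
    rw [show 2 * H - 1 = (H - 1 / 2) + (H - 1 / 2) by ring,
      show 2 * H - 3 = (H - 3 / 2) + (H - 3 / 2) by ring, Real.rpow_add hn', Real.rpow_add hx]
    ring
  have hrow : ∀ k : ℕ, ∑ k' ∈ Finset.Icc 1 n, (|(((k : ℤ) - k' : ℤ) : ℝ)| + 1) ^ (2 * H - 3)
      ≤ Z := by
    intro k
    have hinj : Set.InjOn (fun k' : ℕ => (k : ℤ) - k') (Finset.Icc 1 n) := by
      intro x _ y _ hxy
      simp only at hxy
      omega
    have := Finset.sum_image (f := fun m : ℤ => (|(m : ℝ)| + 1) ^ (2 * H - 3)) hinj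
    rw [← this]
    exact hsm.sum_le_tsum _ fun m _ => by positivity
  calc _ ≤ ∑ k ∈ Finset.Icc 1 n, ∑ k' ∈ Finset.Icc 1 n,
        C ^ 2 * (n : ℝ) ^ (2 * H - 1) * (|(((k : ℤ) - k' : ℤ) : ℝ)| + 1) ^ (2 * H - 3) :=
        Finset.sum_le_sum fun k hk => Finset.sum_le_sum fun k' hk' => hterm k hk k' hk'
    _ ≤ ∑ k ∈ Finset.Icc 1 n, C ^ 2 * (n : ℝ) ^ (2 * H - 1) * Z := by
        refine Finset.sum_le_sum fun k _ => ?_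
        rw [← Finset.mul_sum]
        exact mul_le_mul_of_nonneg_left (hrow k) (by positivity)
    _ = C ^ 2 * Z * ((n : ℝ) ^ (2 * H - 1) * n) := by
        simp only [Finset.sum_const, Nat.card_Icc, Nat.add_sub_cancel, nsmul_eq_mul]
        ring
    _ = C ^ 2 * Z * (n : ℝ) ^ (2 * H) := by
        rw [← Real.rpow_add_one hn'.ne', sub_add_cancel]

/-- Along a polynomial subsequence the normalized lag sums converge almost surely. -/
theorem IsFairSignSequence.exists_ae_tendsto_lagSum (hξ : IsFairSignSequence P ξ)
    (hH : 1 / 2 < H) (hH1 : H < 1) (hσ : 0 < σ) :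
    ∃ p : ℕ, p ≠ 0 ∧ ∀ s t : ℕ, s ≤ 1 → t ≤ 1 → ∀ᵐ ω ∂P, Tendsto (fun j : ℕ =>
      (lagSum H σ ξ s t ((j + 1) ^ p) ω - lagMean H σ s t ((j + 1) ^ p)) / ((j : ℝ) + 1) ^ p)
      atTop (𝓝 0) := by
  obtain ⟨C, hC0, hC⟩ := hξ.exists_variance_lagSum_le hH hH1 hσ
  -- Along `n_j = (j + 1)^p` the normalized variances are `O(n_j^{2H-2})`, summable once `p (2 - 2
  -- H) > 1`.
  obtain ⟨p, hp⟩ := exists_nat_gt (1 / (2 - 2 * H))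
  have hH2 : 0 < 2 - 2 * H := by linarith
  have hp1 : 1 < p * (2 - 2 * H) := (div_lt_iff₀ hH2).1 hp
  refine ⟨p, by rintro rfl; simp at hp1; linarith, fun s t hs ht => ?_⟩
  have hsm : Summable fun j : ℕ => C * ((j : ℝ) + 1) ^ ((p : ℝ) * (2 * H - 2)) := by
    have := (summable_nat_add_iff 1).2
      (Real.summable_nat_rpow.2 (show (p : ℝ) * (2 * H - 2) < -1 by linarith))
    simpa using this.mul_left C
  refine ae_tendsto_zero_of_summable_integral_sq (fun j => ?_) (fun j => ?_) hsm
  · simp only [div_pow]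
    exact (integrable_of_memLp_top
      (memLp_top_sq ((hξ.memLp_top_lagSum s t _).sub (memLp_const _)))).div_const _
  · simp only [div_pow, integral_div]
    have hj : (0 : ℝ) < (j : ℝ) + 1 := by positivity
    rw [div_le_iff₀ (by positivity)]
    refine (hC s t ((j + 1) ^ p) hs ht (Nat.one_le_pow _ _ (by omega))).trans (le_of_eq ?_)
    rw [mul_assoc]
    congr 1
    push_cast
    rw [← Real.rpow_natCast, ← Real.rpow_mul hj.le, ← Real.rpow_natCast, ← Real.rpow_mul hj.le,
      ← Real.rpow_add hj]
    congr 1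
    push_cast
    ring

theorem lagMean_self_sub_le {C : ℝ} (hC : ∀ k, covY H σ k k ≤ C) (s : ℕ) {a b : ℕ} (hab : a ≤ b) :
    lagMean H σ s s b - lagMean H σ s s a ≤ C * ((b : ℝ) - a) := by
  induction b, hab using Nat.le_induction with
  | base => simp
  | succ b _ ih =>
    simp only [lagMean, Finset.sum_Icc_succ_top (show 1 ≤ b + 1 by omega)] at ih ⊢
    have := hC (b + 1 - s)
    push_cast
    linarith

theorem le_lagMean {c : ℝ} (hc0 : 0 < c) (h0 : ∀ k l, 0 ≤ covY H σ k l)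
    (hc : ∀ k, 5 ≤ k → c ≤ covY H σ (k - 1) k) (n : ℕ) :
    c * ((n : ℝ) - 4) ≤ lagMean H σ 1 0 n := by
  induction n with
  | zero =>
    simp only [lagMean, Nat.cast_zero, Finset.Icc_eq_empty_of_lt, zero_lt_one, Finset.sum_empty]
    linarith
  | succ n ih =>
    by_cases hn : 5 ≤ n + 1
    · have := hc (n + 1) hn
      rw [Nat.add_sub_cancel] at this
      simp only [lagMean, Finset.sum_Icc_succ_top (show 1 ≤ n + 1 by omega), Nat.sub_zero,
        Nat.add_sub_cancel] at ih ⊢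
      push_cast
      linarith
    -- The covariance lower bound starts at `k = 5`; the shift by `4` makes the claim trivial before
    -- that.
    · have h1 : (((n + 1 : ℕ) : ℝ)) ≤ 4 := by exact_mod_cast (by omega : n + 1 ≤ 4)
      exact (mul_nonpos_of_nonneg_of_nonpos hc0.le (by linarith)).trans
        (Finset.sum_nonneg fun k _ => h0 _ _)

/-- The sum of the `θ^{(4)}` grows linearly, almost surely. -/
theorem IsFairSignSequence.exists_ae_le_theta4 (hξ : IsFairSignSequence P ξ)
    (hH : 1 / 2 < H) (hH1 : H < 1) (hσ : 0 < σ) :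
    ∃ c : ℝ, 0 < c ∧ ∀ᵐ ω ∂P, ∀ᶠ n : ℕ in atTop, c * n ≤ partialSum (theta4 H σ ξ) n ω := by
  obtain ⟨p, hp, hlim⟩ := hξ.exists_ae_tendsto_lagSum hH hH1 hσ
  obtain ⟨C, hC0, hC⟩ := exists_covY_self_le hH hH1 hσ
  obtain ⟨c, hc0, hc⟩ := exists_le_covY hH hH1 hσ
  refine ⟨c / 2, by positivity, ?_⟩
  have hone : Tendsto (fun j : ℕ => 1 / ((j : ℝ) + 1)) atTop (𝓝 0) :=
    tendsto_one_div_add_atTop_nhds_zero_nat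
  have hinv : Tendsto (fun j : ℕ => (1 / ((j : ℝ) + 1)) ^ p) atTop (𝓝 0) := by
    simpa [hp] using hone.pow p
  have hratio : Tendsto (fun j : ℕ => (1 + 1 / ((j : ℝ) + 1)) ^ p) atTop (𝓝 1) := by
    simpa using (hone.const_add 1).pow p
  filter_upwards [hlim 1 0 le_rfl zero_le_one, hlim 1 1 le_rfl le_rfl,
    hlim 0 0 zero_le_one zero_le_one] with ω hF hG hK
  set F : ℕ → ℝ := fun j => (lagSum H σ ξ 1 0 ((j + 1) ^ p) ω - lagMean H σ 1 0 ((j + 1) ^ p))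
    / ((j : ℝ) + 1) ^ p with hFdef
  set G : ℕ → ℝ := fun j => (lagSum H σ ξ 1 1 ((j + 1) ^ p) ω - lagMean H σ 1 1 ((j + 1) ^ p))
    / ((j : ℝ) + 1) ^ p with hGdef
  set K : ℕ → ℝ := fun j => (lagSum H σ ξ 0 0 ((j + 1) ^ p) ω - lagMean H σ 0 0 ((j + 1) ^ p))
    / ((j : ℝ) + 1) ^ p with hKdef
  have hG' : Tendsto (fun j => G (j + 1)) atTop (𝓝 0) := hG.comp (tendsto_add_atTop_nat 1)
  have hK' : Tendsto (fun j => K (j + 1)) atTop (𝓝 0) := hK.comp (tendsto_add_atTop_nat 1)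
  -- With `A = n_j` and `B = n_{j+1}`, this is a lower bound, divided by `A`, for the lag sum
  -- throughout the block, minus `c / 2 * B / A`. As `B / A → 1`, its limit is `c / 2 > 0`.
  have hL : Tendsto (fun j : ℕ => c * (1 - 4 * (1 / ((j : ℝ) + 1)) ^ p) + F j
      - C * ((1 + 1 / ((j : ℝ) + 1)) ^ p - 1)
      - (((1 + 1 / ((j : ℝ) + 1)) ^ p * G (j + 1) - G j)
        + ((1 + 1 / ((j : ℝ) + 1)) ^ p * K (j + 1) - K j)) / 2
      - c / 2 * (1 + 1 / ((j : ℝ) + 1)) ^ p) atTop (𝓝 (c * (1 - 4 * 0) + 0 - C * (1 - 1)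
      - ((1 * 0 - 0) + (1 * 0 - 0)) / 2 - c / 2 * 1)) :=
    ((((((hinv.const_mul 4).const_sub 1).const_mul c).add hF).sub
      ((hratio.sub_const 1).const_mul C)).sub
      ((((hratio.mul hG').sub hG).add ((hratio.mul hK').sub hK)).div_const 2)).sub
      (hratio.const_mul _)
  have hpos : 0 < c * (1 - 4 * 0) + 0 - C * (1 - 1)
      - ((1 * 0 - 0) + (1 * 0 - 0)) / 2 - c / 2 * 1 := by linarith
  obtain ⟨J, hJ⟩ := eventually_atTop.1 (hL.eventually (lt_mem_nhds hpos))
  have hblock : ∀ j, J ≤ j → ∀ n, (j + 1) ^ p ≤ n → n ≤ (j + 1 + 1) ^ p →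
      c / 2 * n ≤ lagSum H σ ξ 1 0 n ω := by
    intro j hj n hn1 hn2
    have hLj := hJ j hj
    set A : ℝ := ((j : ℝ) + 1) ^ p with hA
    set B : ℝ := ((j : ℝ) + 1 + 1) ^ p with hB
    have hA0 : 0 < A := by positivity
    have hB0 : 0 < B := by positivity
    have hcA : (((j + 1) ^ p : ℕ) : ℝ) = A := by push_cast; rfl
    have hcB : (((j + 1 + 1) ^ p : ℕ) : ℝ) = B := by push_cast; rfl
    have hr : (1 + 1 / ((j : ℝ) + 1)) ^ p = B / A := by
      rw [hA, hB, ← div_pow]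
      congr 1
      field_simp
    have hi : (1 / ((j : ℝ) + 1)) ^ p = 1 / A := by rw [one_div_pow]
    rw [hr, hi] at hLj
    have e1 : lagSum H σ ξ 1 0 ((j + 1) ^ p) ω = lagMean H σ 1 0 ((j + 1) ^ p) + A * F j := by
      simp only [hFdef]
      field_simp
      ring
    have e2 : ∀ s, lagSum H σ ξ s s ((j + 1) ^ p) ω = lagMean H σ s s ((j + 1) ^ p)
        + A * ((lagSum H σ ξ s s ((j + 1) ^ p) ω - lagMean H σ s s ((j + 1) ^ p)) / A) := by
      intro s
      field_simp
      ring
    have e3 : ∀ s, lagSum H σ ξ s s ((j + 1 + 1) ^ p) ω = lagMean H σ s s ((j + 1 + 1) ^ p)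
        + B * ((lagSum H σ ξ s s ((j + 1 + 1) ^ p) ω - lagMean H σ s s ((j + 1 + 1) ^ p))
          / ((((j + 1 : ℕ) : ℝ) + 1) ^ p)) := by
      intro s
      rw [show (((j + 1 : ℕ) : ℝ) + 1) ^ p = B by push_cast; rfl]
      field_simp
      ring
    have g1 := e2 1
    have g2 := e2 0
    have g3 := e3 1
    have g4 := e3 0
    have m0 := le_lagMean hc0 (covY_nonneg hH hH1 hσ) hc ((j + 1) ^ p)
    have m1 := lagMean_self_sub_le hC 1 (hn1.trans hn2)
    have m2 := lagMean_self_sub_le hC 0 (hn1.trans hn2)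
    have hsub := lagSum_sub_le (H := H) (σ := σ) (ξ := ξ) hn1 hn2 ω
    rw [hcA] at m0 m1 m2
    rw [hcB] at m1 m2
    have hnB : (n : ℝ) ≤ B := by rw [← hcB]; exact_mod_cast hn2
    have hmul := mul_pos hA0 hLj
    have hexp : A * (c * (1 - 4 * (1 / A)) + F j - C * (B / A - 1)
        - (B / A * G (j + 1) - G j + (B / A * K (j + 1) - K j)) / 2 - c / 2 * (B / A))
        = c * (A - 4) + A * F j - C * (B - A)
        - (B * G (j + 1) - A * G j + (B * K (j + 1) - A * K j)) / 2 - c / 2 * B := by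
      field_simp
    rw [hexp] at hmul
    change _ = _ + A * G j at g1
    change _ = _ + A * K j at g2
    change _ = _ + B * G (j + 1) at g3
    change _ = _ + B * K (j + 1) at g4
    have hcn : c / 2 * n ≤ c / 2 * B := mul_le_mul_of_nonneg_left hnB (by positivity)
    linarith
  have hθ : ∀ n, partialSum (theta4 H σ ξ) n ω = lagSum H σ ξ 1 0 n ω := fun n => rfl
  filter_upwards [eventually_ge_atTop ((J + 1) ^ p)] with n hn
  rw [hθ]
  have hlt : ∀ j : ℕ, j < (j + 1) ^ p := fun j =>
    (Nat.lt_succ_self j).trans_le (Nat.le_self_pow hp _)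
  -- The block containing `n`: the largest `j` with `(j + 1)^p ≤ n`.
  set j := Nat.findGreatest (fun j => (j + 1) ^ p ≤ n) n with hj
  have hJn : J ≤ n := (hlt J).le.trans hn
  have hspec : (j + 1) ^ p ≤ n := Nat.findGreatest_spec (P := fun j => (j + 1) ^ p ≤ n) hJn hn
  refine hblock j (Nat.le_findGreatest hJn hn) n hspec ?_
  by_contra hcon
  have hcon' : (j + 1 + 1) ^ p ≤ n := (not_le.1 hcon).le
  have := Nat.le_findGreatest (P := fun j => (j + 1) ^ p ≤ n)
    ((hlt (j + 1)).le.trans hcon') hcon'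
  omega

end LagSums

/-! ### Frictionless trading -/

section Trading

variable {Ω : Type*}

/-- Without costs the positive and negative parts recombine, and summation by parts turns the
accumulated bond position into trading gains. -/
theorem liquidationValue_ofStock (S φ : ℕ → Ω → ℝ) (n : ℕ) (ω : Ω) :
    liquidationValue S 0 (ofStock S 0 φ) n ω
      = ∑ k ∈ Finset.range n, φ k ω * (S (k + 1) ω - S k ω) := by
  have hpn : ∀ x : ℝ, x⁺ = x + x⁻ := fun x => by linarith [posPart_sub_negPart x]
  induction n with
  | zero =>
    simp only [liquidationValue, ofStock, increment, zero_add, Finset.sum_range_one,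
      Finset.range_zero, Finset.sum_empty, sub_zero, hpn]
    ring
  | succ n ih =>
    rw [Finset.sum_range_succ, ← ih]
    simp only [liquidationValue, ofStock, Finset.sum_range_succ _ (n + 1), increment, sub_zero, hpn]
    ring

theorem isSelfFinancing_ofStock {ξ S φ : ℕ → Ω → ℝ} {N : ℕ}
    (hS : ∀ n, Measurable[info ξ n] (S n)) (hφ : ∀ n, Measurable[info ξ n] (φ n)) :
    IsSelfFinancing ξ S 0 N (ofStock S 0 φ) where
  adapted_bond n _ := by
    have hinc : ∀ k, Measurable[info ξ k] (increment 0 φ k) := by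
      intro k
      rcases k with _ | k
      · exact (hφ 0).sub measurable_const
      · exact (hφ (k + 1)).sub ((hφ k).mono (info_mono (Nat.le_succ k)) le_rfl)
    have hmono : ∀ k ∈ Finset.range (n + 1), info ξ k ≤ info ξ n := fun k hk =>
      info_mono (Nat.lt_succ_iff.1 (Finset.mem_range.1 hk))
    refine (measurable_const.sub (Finset.measurable_fun_sum _ fun k hk => ?_)).add
      (measurable_const.mul (Finset.measurable_fun_sum _ fun k hk => ?_))
    · exact ((((hinc k).max measurable_const)).mul (hS k)).mono (hmono k hk) le_rfl
    · exact ((((hinc k).neg.max measurable_const)).mul (hS k)).mono (hmono k hk) le_rfl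
  adapted_stock n _ := hφ n
  financing n _ ω := by
    rcases n with _ | n
    · simp [ofStock, increment]
    · refine le_of_eq ?_
      change (ofStock S 0 φ).bond (n + 1) ω - (ofStock S 0 φ).bond n ω = _
      simp only [ofStock, Finset.sum_range_succ _ (n + 1)]
      ring

variable {ξ : ℕ → Ω → ℝ} {H σ s₀ : ℝ}

/-! ### Adaptedness of the prices and of the stopped position. -/

theorem xProc_zero (ω : Ω) : xProc H σ ξ 0 ω = 0 := by simp [xProc, yProc, gCoef]

theorem measurable_info_xProc (k : ℕ) : Measurable[info ξ k] (xProc H σ ξ k) := by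
  rcases k with _ | k
  · rw [show xProc H σ ξ 0 = fun _ => 0 from funext xProc_zero]
    exact measurable_const
  · exact (measurable_info_yProc (by omega)).add
      (measurable_const.mul (measurable_info (by omega) le_rfl))

theorem measurable_info_stockPrice (N n : ℕ) :
    Measurable[info ξ n] (stockPrice H σ s₀ ξ N n) := by
  induction n with
  | zero => exact measurable_const
  | succ n ih =>
    exact (measurable_const.add ((measurable_info_xProc (n + 1)).div_const _)).mul
      (ih.mono (info_mono (Nat.le_succ n)) le_rfl)

theorem lt_dropTime_iff (θ : ℕ → Ω → ℝ) (N : ℕ) (ε : ℝ) (ω : Ω) (k : ℕ) :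
    (k : ℕ∞) < dropTime θ N ε ω ↔
      ∀ m ∈ Finset.Icc 1 N, m ≤ k → -ε ≤ 1 / (N : ℝ) * partialSum θ m ω := by
  rw [← ENat.add_one_le_iff (ENat.natCast_ne_top k), dropTime]
  simp only [le_iInf_iff]
  constructor
  · intro h m hm hmk
    by_contra hcon
    have := h m ⟨hm, not_le.1 hcon⟩
    norm_cast at this
    omega
  · rintro h m ⟨hm, hlt⟩
    norm_cast
    by_contra hcon
    exact absurd (h m hm (by omega)) (not_le.2 hlt)

/-- Subtracting one from a drop time means looking one step ahead, which is why the last two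
conditions reach to `k + 1`. This form serves both adaptedness and the value bounds. -/
theorem lt_stopTime_iff (N : ℕ) (ω : Ω) (k : ℕ) :
    (k : ℕ∞) < stopTime H σ ξ N ω ↔ ∀ m ∈ Finset.Icc 1 N,
      (m ≤ k → -eps H N ≤ 1 / (N : ℝ) * partialSum (theta1 H σ ξ) m ω) ∧
      (m ≤ k → -eps H N ≤ 1 / (N : ℝ) * partialSum (theta2 H σ ξ) m ω) ∧
      (m ≤ k + 1 → -eps H N ≤ 1 / (N : ℝ) * partialSum (theta3 H σ ξ) m ω) ∧
      (m ≤ k + 1 → -eps H N ≤ 1 / (N : ℝ) * partialSum (theta4 H σ ξ) m ω) := by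
  have hsub : ∀ d : ℕ∞, (k : ℕ∞) < d - 1 ↔ ((k + 1 : ℕ) : ℕ∞) < d := fun d => by
    rw [lt_tsub_iff_right]
    norm_cast
  simp only [stopTime, lt_min_iff, hsub, lt_dropTime_iff]
  constructor
  · rintro ⟨⟨h1, h2⟩, h3, h4⟩ m hm
    exact ⟨h1 m hm, h2 m hm, h3 m hm, h4 m hm⟩
  · intro h
    exact ⟨⟨fun m hm => (h m hm).1, fun m hm => (h m hm).2.1⟩,
      fun m hm => (h m hm).2.2.1, fun m hm => (h m hm).2.2.2⟩

/-- The lag `d` says how far in advance a summand is known: `0` for `θ^{(1)}, θ^{(2)}` and `1` for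
`θ^{(3)}, θ^{(4)}`. The latter is what makes stopping one step before a drop non-anticipative. -/
theorem measurable_info_partialSum {θ : ℕ → Ω → ℝ} {d : ℕ}
    (hθ : ∀ k, 1 ≤ k → Measurable[info ξ (k - d)] (θ k)) {m n : ℕ} (hmn : m ≤ n + d) :
    Measurable[info ξ n] (partialSum θ m) :=
  Finset.measurable_fun_sum _ fun k hk => by
    rw [Finset.mem_Icc] at hk
    exact (hθ k hk.1).mono (info_mono (by omega)) le_rfl

theorem measurable_info_gCoef_mul (k : ℕ) :
    Measurable[info ξ k] (fun ω => gCoef H σ k * ξ k ω) := by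
  rcases k with _ | k
  · simp only [gCoef, if_true, zero_mul]
    exact measurable_const
  · exact measurable_const.mul (measurable_info (by omega) le_rfl)

theorem measurable_info_theta1 (k : ℕ) : Measurable[info ξ (k - 0)] (theta1 H σ ξ k) := by
  have h : theta1 H σ ξ k = fun ω =>
      (gCoef H σ (k - 1) * ξ (k - 1) ω) * (gCoef H σ k * ξ k ω) := by
    funext ω
    simp only [theta1]
    ring
  rw [h]
  exact ((measurable_info_gCoef_mul (k - 1)).mono (info_mono (by omega)) le_rfl).mul
    (measurable_info_gCoef_mul k)

theorem measurable_info_theta2 (k : ℕ) : Measurable[info ξ (k - 0)] (theta2 H σ ξ k) :=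
  (measurable_info_gCoef_mul k).mul (measurable_info_yProc (by omega))

theorem measurable_info_theta3 (k : ℕ) : Measurable[info ξ (k - 1)] (theta3 H σ ξ k) :=
  (measurable_info_gCoef_mul (k - 1)).mul (measurable_info_yProc (by omega))

theorem measurable_info_theta4 (k : ℕ) : Measurable[info ξ (k - 1)] (theta4 H σ ξ k) :=
  (measurable_info_yProc (by omega)).mul (measurable_info_yProc (by omega))

theorem measurableSet_info_lt_stopTime (N k : ℕ) :
    MeasurableSet[info ξ k] {ω | (k : ℕ∞) < stopTime H σ ξ N ω} := by
  have hset : ∀ {θ : ℕ → Ω → ℝ} {d : ℕ}, (∀ k, Measurable[info ξ (k - d)] (θ k)) → ∀ m,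
      MeasurableSet[info ξ k]
        {ω | m ≤ k + d → -eps H N ≤ 1 / (N : ℝ) * partialSum θ m ω} := by
    intro θ d hθ m
    by_cases hm : m ≤ k + d
    · simp only [hm, forall_const]
      have h1 : Measurable[info ξ k] fun ω => 1 / (N : ℝ) * partialSum θ m ω :=
        measurable_const.mul (measurable_info_partialSum (fun k _ => hθ k) hm)
      exact h1 measurableSet_Ici
    · simp only [hm, false_imp_iff]
      exact MeasurableSet.univ
  have : {ω | (k : ℕ∞) < stopTime H σ ξ N ω} = ⋂ m ∈ Finset.Icc 1 N,
      ({ω | m ≤ k + 0 → -eps H N ≤ 1 / (N : ℝ) * partialSum (theta1 H σ ξ) m ω} ∩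
      ({ω | m ≤ k + 0 → -eps H N ≤ 1 / (N : ℝ) * partialSum (theta2 H σ ξ) m ω} ∩
      ({ω | m ≤ k + 1 → -eps H N ≤ 1 / (N : ℝ) * partialSum (theta3 H σ ξ) m ω} ∩
      {ω | m ≤ k + 1 → -eps H N ≤ 1 / (N : ℝ) * partialSum (theta4 H σ ξ) m ω}))) := by
    ext ω
    rw [Set.mem_ofPred_eq, lt_stopTime_iff, Set.mem_iInter₂]
    rfl
  rw [this]
  exact Finset.measurableSet_biInter _ fun m _ =>
    (hset measurable_info_theta1 m).inter ((hset measurable_info_theta2 m).inter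
      ((hset measurable_info_theta3 m).inter (hset measurable_info_theta4 m)))

theorem measurable_info_stoppedStock (N k : ℕ) :
    Measurable[info ξ k] (stoppedStock H σ s₀ ξ N k) := by
  have hφ : Measurable[info ξ k] (phiStock H σ s₀ ξ N k) := by
    unfold phiStock
    split_ifs with h
    · exact measurable_const
    · exact measurable_const.mul
        ((measurable_info_xProc k).div (measurable_info_stockPrice N k))
  exact Measurable.ite (measurableSet_info_lt_stopTime N k) hφ measurable_const

theorem isSelfFinancing_psi (C : ℝ) (N : ℕ) :
    IsSelfFinancing ξ (stockPrice H σ s₀ ξ N) 0 N (psi H σ s₀ C ξ N) :=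
  isSelfFinancing_ofStock (fun n => measurable_info_stockPrice N n)
    fun n => measurable_const.mul (measurable_info_stoppedStock N n)

/-! ### The value of the stopped strategy and its lower bound. -/

theorem sum_xProc_mul_eq (m : ℕ) (ω : Ω) :
    ∑ k ∈ Finset.range m, xProc H σ ξ k ω * xProc H σ ξ (k + 1) ω
      = partialSum (theta1 H σ ξ) m ω + partialSum (theta2 H σ ξ) m ω
        + partialSum (theta3 H σ ξ) m ω + partialSum (theta4 H σ ξ) m ω := by
  induction m with
  | zero => simp [partialSum]
  | succ m ih =>
    simp only [partialSum, Finset.sum_Icc_succ_top (show 1 ≤ m + 1 by omega)] at ih ⊢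
    rw [Finset.sum_range_succ, ih]
    simp only [theta1, theta2, theta3, theta4, xProc, Nat.add_sub_cancel]
    ring

theorem stoppedStock_mul_sub {N : ℕ} (hN : 1 ≤ N) {k : ℕ} {ω : Ω}
    (hk : (k : ℕ∞) < stopTime H σ ξ N ω) (hS : stockPrice H σ s₀ ξ N k ω ≠ 0) :
    stoppedStock H σ s₀ ξ N k ω
        * (stockPrice H σ s₀ ξ N (k + 1) ω - stockPrice H σ s₀ ξ N k ω)
      = 1 / (N : ℝ) * (xProc H σ ξ k ω * xProc H σ ξ (k + 1) ω) := by
  have hN' : (0 : ℝ) < N := by exact_mod_cast hN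
  rw [stoppedStock, if_pos hk, phiStock]
  split_ifs with h0
  · rw [h0, xProc_zero]
    ring
  · simp only [stockPrice]
    rw [Real.rpow_sub_one hN'.ne']
    have hNH : (N : ℝ) ^ H ≠ 0 := by positivity
    field_simp
    ring

/-- The value of the stopped strategy is a sum up to a time `m` not after the stopping time. -/
theorem exists_liquidationValue_psi_eq (C : ℝ) {N : ℕ} (hN : 1 ≤ N) (ω : Ω) (n : ℕ) :
    ∃ m ≤ n, (m : ℕ∞) ≤ stopTime H σ ξ N ω ∧
      liquidationValue (stockPrice H σ s₀ ξ N) 0 (psi H σ s₀ C ξ N) n ω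
        = 1 / √(cHat H C N) * (1 / (N : ℝ) *
          ∑ k ∈ Finset.range m, xProc H σ ξ k ω * xProc H σ ξ (k + 1) ω) ∧
      (m = n ∨ ¬ (n : ℕ∞) < stopTime H σ ξ N ω ∨ stockPrice H σ s₀ ξ N n ω = 0) := by
  simp only [psi, liquidationValue_ofStock]
  -- The final alternative is the induction invariant: either every product so far has been counted,
  -- or trading has ended by stopping or by a zero price. Both endings are permanent, since the
  -- price recursion is multiplicative.
  induction n with
  | zero => exact ⟨0, le_rfl, by simp, by simp, Or.inl rfl⟩
  | succ n ih =>
    obtain ⟨m, hmn, hmT, hV, hdead⟩ := ih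
    rw [Finset.sum_range_succ, hV]
    by_cases hlive : (n : ℕ∞) < stopTime H σ ξ N ω ∧ stockPrice H σ s₀ ξ N n ω ≠ 0
    · have hmeq : m = n := by
        rcases hdead with h | h | h
        · exact h
        · exact absurd hlive.1 h
        · exact absurd h hlive.2
      subst hmeq
      refine ⟨m + 1, le_rfl, ?_, ?_, Or.inl rfl⟩
      · exact_mod_cast Order.add_one_le_of_lt hlive.1
      · rw [Finset.sum_range_succ, mul_assoc (1 / √(cHat H C N)),
          stoppedStock_mul_sub hN hlive.1 hlive.2]
        ring
    · rw [not_and_or, not_not] at hlive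
      refine ⟨m, hmn.trans (Nat.le_succ n), hmT, ?_, Or.inr ?_⟩
      · rcases hlive with h | h
        · simp only [stoppedStock, if_neg h]
          ring
        · simp only [stockPrice, h]
          ring
      · rcases hlive with h | h
        · refine Or.inl fun h' => h (lt_trans ?_ h')
          exact_mod_cast Nat.lt_succ_self n
        · exact Or.inr (by simp only [stockPrice, h, mul_zero])

theorem eps_nonneg (H : ℝ) {N : ℕ} (hN : 1 ≤ N) : 0 ≤ eps H N :=
  div_nonneg (Real.log_nonneg (by exact_mod_cast hN)) (by positivity)

theorem cHat_pos (H : ℝ) {C : ℝ} (hC : 0 < C) {N : ℕ} (hN : 1 ≤ N) : 0 < cHat H C N := by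
  have := eps_nonneg H hN
  have hN' : (0 : ℝ) < N := by exact_mod_cast hN
  unfold cHat
  positivity

variable [MeasurableSpace Ω] {P : Measure Ω}

/-- The value is a sum up to some `m ≤ T_N`. There the sums of `θ^{(3)}` and `θ^{(4)}` are still
above `-ε_N N`. Those of `θ^{(1)}` and `θ^{(2)}` are so at `m - 1`, and the last summand costs at
most `C_i N^{H-1/2}`. Altogether the unscaled loss is at most `ĉ_N`. -/
theorem ae_le_liquidationValue_psi {C₁ C₂ : ℝ} (h₁ : IsThetaBound P H (theta1 H σ ξ) C₁)
    (h₂ : IsThetaBound P H (theta2 H σ ξ) C₂) {N : ℕ} (hN : 1 ≤ N) {n : ℕ} (hn : n ≤ N) :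
    ∀ᵐ ω ∂P, -√(cHat H (C₁ + C₂) N)
      ≤ liquidationValue (stockPrice H σ s₀ ξ N) 0 (psi H σ s₀ (C₁ + C₂) ξ N) n ω := by
  have hN' : (0 : ℝ) < N := by exact_mod_cast hN
  have hε := eps_nonneg H hN
  have hc := cHat_pos H (add_pos h₁.1 h₂.1) hN
  have hb₁ : ∀ᵐ ω ∂P, ∀ m ∈ Finset.Icc 1 N, |theta1 H σ ξ m ω| ≤ C₁ * (N : ℝ) ^ (H - 1 / 2) :=
    (ae_ball_iff (Finset.countable_toSet _)).2 (h₁.2 N hN)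
  have hb₂ : ∀ᵐ ω ∂P, ∀ m ∈ Finset.Icc 1 N, |theta2 H σ ξ m ω| ≤ C₂ * (N : ℝ) ^ (H - 1 / 2) :=
    (ae_ball_iff (Finset.countable_toSet _)).2 (h₂.2 N hN)
  filter_upwards [hb₁, hb₂] with ω hω₁ hω₂
  obtain ⟨m, hmn, hmT, hV, -⟩ :=
    exists_liquidationValue_psi_eq (H := H) (σ := σ) (s₀ := s₀) (ξ := ξ) (C₁ + C₂) hN ω n
  have hmain : -cHat H (C₁ + C₂) N ≤ 1 / (N : ℝ) *
      ∑ k ∈ Finset.range m, xProc H σ ξ k ω * xProc H σ ξ (k + 1) ω := by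
    rcases m with _ | m
    · simpa using hc.le
    have hmN : m + 1 ∈ Finset.Icc 1 N := Finset.mem_Icc.2 ⟨by omega, by omega⟩
    have hlt : (m : ℕ∞) < stopTime H σ ξ N ω :=
      lt_of_lt_of_le (by exact_mod_cast Nat.lt_succ_self m) hmT
    rw [lt_stopTime_iff] at hlt
    obtain ⟨-, -, h3, h4⟩ := hlt (m + 1) hmN
    have hprev : -eps H N ≤ 1 / (N : ℝ) * partialSum (theta1 H σ ξ) m ω ∧
        -eps H N ≤ 1 / (N : ℝ) * partialSum (theta2 H σ ξ) m ω := by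
      rcases Nat.eq_zero_or_pos m with rfl | hm
      · simp [partialSum, hε]
      · obtain ⟨h1, h2, -, -⟩ := hlt m (Finset.mem_Icc.2 ⟨hm, by omega⟩)
        exact ⟨h1 le_rfl, h2 le_rfl⟩
    have hs : ∀ θ : ℕ → Ω → ℝ, partialSum θ (m + 1) ω = partialSum θ m ω + θ (m + 1) ω :=
      fun θ => Finset.sum_Icc_succ_top (by omega) _
    have e1 := (abs_le.1 (hω₁ _ hmN)).1
    have e2 := (abs_le.1 (hω₂ _ hmN)).1
    have hpow : (N : ℝ) ^ (H - 1 / 2) = N * (1 / (N : ℝ) ^ (3 / 2 - H)) := by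
      rw [show H - 1 / 2 = 1 - (3 / 2 - H) by ring, Real.rpow_sub hN', Real.rpow_one,
        mul_one_div]
    have e1' : -(C₁ / (N : ℝ) ^ (3 / 2 - H)) ≤ 1 / (N : ℝ) * theta1 H σ ξ (m + 1) ω := by
      have := mul_le_mul_of_nonneg_left e1 (one_div_nonneg.2 hN'.le)
      refine le_trans (le_of_eq ?_) this
      rw [hpow]
      field_simp
    have e2' : -(C₂ / (N : ℝ) ^ (3 / 2 - H)) ≤ 1 / (N : ℝ) * theta2 H σ ξ (m + 1) ω := by
      have := mul_le_mul_of_nonneg_left e2 (one_div_nonneg.2 hN'.le)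
      refine le_trans (le_of_eq ?_) this
      rw [hpow]
      field_simp
    rw [sum_xProc_mul_eq, hs (theta1 H σ ξ), hs (theta2 H σ ξ), cHat, add_div]
    have h3' := h3 le_rfl
    have h4' := h4 le_rfl
    simp only [mul_add]
    linarith [hprev.1, hprev.2]
  rw [hV]
  have hsq : 0 < √(cHat H (C₁ + C₂) N) := Real.sqrt_pos.2 hc
  have := mul_le_mul_of_nonneg_left hmain (one_div_nonneg.2 hsq.le)
  refine le_trans (le_of_eq ?_) this
  rw [mul_neg, one_div, neg_inj, inv_mul_eq_div, Real.div_sqrt]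

end Trading

/-! ### The strong asymptotic arbitrage -/

section Arbitrage

theorem tendsto_log_natCast_atTop : Tendsto (fun N : ℕ => Real.log N) atTop atTop :=
  Real.tendsto_log_atTop.comp tendsto_natCast_atTop_atTop

theorem tendsto_eps {H : ℝ} (hH1 : H < 1) : Tendsto (eps H) atTop (𝓝 0) := by
  have hδ : 0 < min (1 / 2) (2 - 2 * H) := lt_min (by norm_num) (by linarith)
  exact ((isLittleO_log_rpow_atTop hδ).tendsto_div_nhds_zero).comp tendsto_natCast_atTop_atTop

theorem log_le_eps_mul {H : ℝ} {N : ℕ} (hN : 1 ≤ N) : Real.log N ≤ eps H N * N := by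
  have hN' : (1 : ℝ) ≤ N := by exact_mod_cast hN
  have hle : (N : ℝ) ^ min (1 / 2) (2 - 2 * H) ≤ N :=
    (Real.rpow_le_rpow_of_exponent_le hN'
      ((min_le_left _ _).trans (by norm_num : (1 / 2 : ℝ) ≤ 1))).trans_eq (Real.rpow_one _)
  rw [eps, div_mul_eq_mul_div, le_div_iff₀ (by positivity)]
  exact mul_le_mul_of_nonneg_left hle (Real.log_nonneg hN')

/-- As the exponent in `ε_N` is at most `1/2`, the bound `D N / (ε_N N)^2` from the maximal
inequality is at most `|D| / (ln N)^2`. -/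
theorem log_sq_mul_le {H : ℝ} {N : ℕ} (hN : 1 ≤ N) :
    Real.log N ^ 2 * N ≤ (eps H N * N) ^ 2 := by
  have hN' : (1 : ℝ) ≤ N := by exact_mod_cast hN
  have hN0 : (0 : ℝ) < N := by linarith
  have hle : ((N : ℝ) ^ min (1 / 2) (2 - 2 * H)) ^ 2 ≤ N := by
    calc ((N : ℝ) ^ min (1 / 2) (2 - 2 * H)) ^ 2 ≤ ((N : ℝ) ^ (1 / 2 : ℝ)) ^ 2 :=
          pow_le_pow_left₀ (by positivity)
            (Real.rpow_le_rpow_of_exponent_le hN' (min_le_left _ _)) 2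
      _ = N := by rw [← Real.sqrt_eq_rpow, Real.sq_sqrt hN0.le]
  rw [eps, div_mul_eq_mul_div, div_pow, le_div_iff₀ (by positivity), mul_pow, mul_assoc]
  refine mul_le_mul_of_nonneg_left ?_ (sq_nonneg _)
  rw [sq (N : ℝ)]
  exact mul_le_mul_of_nonneg_left hle hN0.le

theorem tendsto_cHat {H : ℝ} (hH1 : H < 1) (C : ℝ) : Tendsto (cHat H C) atTop (𝓝 0) := by
  have h1 : Tendsto (fun N : ℕ => (N : ℝ) ^ (3 / 2 - H)) atTop atTop :=
    (tendsto_rpow_atTop (by linarith)).comp tendsto_natCast_atTop_atTop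
  have := ((tendsto_eps hH1).const_mul 4).add (h1.const_div_atTop C)
  rwa [mul_zero, add_zero] at this

variable {Ω : Type*} [MeasurableSpace Ω] {P : Measure Ω} {ξ : ℕ → Ω → ℝ} {H σ s₀ : ℝ}

/-- A bound of the order `N / c ^ 2` makes drops below `-ε_N N` unlikely. -/
theorem tendsto_measure_drop {θ : ℕ → Ω → ℝ} {D : ℝ}
    (h : ∀ (N : ℕ) (c : ℝ), 0 < c → P {ω | ∃ n ∈ Finset.Icc 1 N, partialSum θ n ω < -c}
        ≤ ENNReal.ofReal (D * N / c ^ 2)) :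
    Tendsto (fun N : ℕ => P {ω | ∃ n ∈ Finset.Icc 1 N, partialSum θ n ω < -(eps H N * N)})
      atTop (𝓝 0) := by
  have hlim : Tendsto (fun N : ℕ => ENNReal.ofReal (|D| / Real.log N ^ 2)) atTop (𝓝 0) := by
    have h1 : Tendsto (fun N : ℕ => Real.log N ^ 2) atTop atTop :=
      (tendsto_pow_atTop two_ne_zero).comp tendsto_log_natCast_atTop
    simpa using ENNReal.tendsto_ofReal (h1.const_div_atTop |D|)
  refine tendsto_of_tendsto_of_tendsto_of_le_of_le' tendsto_const_nhds hlim
    (Eventually.of_forall fun _ => zero_le) ?_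
  filter_upwards [tendsto_log_natCast_atTop.eventually_gt_atTop 0, eventually_ge_atTop 1]
    with N hlog hN
  have hN0 : (0 : ℝ) < N := by exact_mod_cast hN
  have hc : 0 < eps H N * N := hlog.trans_le (log_le_eps_mul hN)
  refine (h N _ hc).trans (ENNReal.ofReal_le_ofReal ?_)
  rw [div_le_div_iff₀ (by positivity) (by positivity)]
  calc D * N * Real.log N ^ 2 = D * (Real.log N ^ 2 * N) := by ring
    _ ≤ |D| * (Real.log N ^ 2 * N) := by
        gcongr
        exact le_abs_self D
    _ ≤ |D| * (eps H N * N) ^ 2 :=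
        mul_le_mul_of_nonneg_left (log_sq_mul_le hN) (abs_nonneg D)

variable [IsProbabilityMeasure P]

/-- Almost sure linear growth makes drops below `-ε_N N` and small terminal values unlikely. -/
theorem tendsto_measure_drop_of_ae_le {θ : ℕ → Ω → ℝ} {c : ℝ} (hc : 0 < c)
    (hθ : ∀ n, Measurable (partialSum θ n))
    (h : ∀ᵐ ω ∂P, ∀ᶠ n : ℕ in atTop, c * n ≤ partialSum θ n ω) :
    Tendsto (fun N : ℕ => P ({ω | ∃ n ∈ Finset.Icc 1 N, partialSum θ n ω < -(eps H N * N)}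
      ∪ {ω | partialSum θ N ω < c * N})) atTop (𝓝 0) := by
  -- It suffices, by dominated convergence of indicators, that almost every path lies in only
  -- finitely many of these events.
  rw [← measure_empty (μ := P)]
  refine tendsto_measure_of_ae_tendsto_indicator_of_isFiniteMeasure atTop MeasurableSet.empty
    (fun N => ?_) ?_
  · refine MeasurableSet.union ?_ (measurableSet_lt (hθ N) measurable_const)
    have : {ω | ∃ n ∈ Finset.Icc 1 N, partialSum θ n ω < -(eps H N * N)}
        = ⋃ n ∈ Finset.Icc 1 N, {ω | partialSum θ n ω < -(eps H N * N)} := by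
      ext ω
      simp
    rw [this]
    exact Finset.measurableSet_biUnion _ fun n _ => measurableSet_lt (hθ n) measurable_const
  · filter_upwards [h] with ω hω
    obtain ⟨n₀, hn₀⟩ := eventually_atTop.1 hω
    -- Only the first `n₀` partial sums can be negative, so the whole path is bounded below by a
    -- finite random constant, which `ln N ≤ ε_N N` eventually exceeds.
    have hlow : ∀ n, -∑ k ∈ Finset.range n₀, |partialSum θ k ω| ≤ partialSum θ n ω := by
      intro n
      by_cases hn : n < n₀
      · have := Finset.single_le_sum (f := fun k => |partialSum θ k ω|)
          (fun k _ => abs_nonneg _) (Finset.mem_range.2 hn)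
        linarith [neg_abs_le (partialSum θ n ω)]
      · refine le_trans ?_ (hn₀ n (not_lt.1 hn))
        have h1 : 0 ≤ ∑ k ∈ Finset.range n₀, |partialSum θ k ω| :=
          Finset.sum_nonneg fun k _ => abs_nonneg _
        have h2 : 0 ≤ c * n := by positivity
        linarith
    filter_upwards [eventually_ge_atTop n₀, eventually_ge_atTop 1,
      tendsto_log_natCast_atTop.eventually_ge_atTop (∑ k ∈ Finset.range n₀, |partialSum θ k ω|)]
      with N hN hN1 hlog
    refine iff_of_false ?_ (Set.notMem_empty _)
    rintro (⟨n, -, hn⟩ | hlt)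
    · have := hlow n
      have := log_le_eps_mul (H := H) hN1
      linarith
    · exact absurd (hn₀ N hN) (not_le.2 hlt)

/-- The stock price is positive for all large horizons. -/
theorem IsFairSignSequence.eventually_stockPrice_pos (hξ : IsFairSignSequence P ξ)
    (hH : 1 / 2 < H) (hH1 : H < 1) (hσ : 0 < σ) (hs₀ : 0 < s₀) :
    ∀ᶠ N : ℕ in atTop, ∀ᵐ ω ∂P, ∀ n ≤ N, 0 < stockPrice H σ s₀ ξ N n ω := by
  obtain ⟨C, hC, hX⟩ := hξ.exists_abs_xProc_le hH hH1 hσ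
  have hroot : Tendsto (fun N : ℕ => (N : ℝ) ^ (1 / 2 : ℝ)) atTop atTop :=
    (tendsto_rpow_atTop (by norm_num)).comp tendsto_natCast_atTop_atTop
  filter_upwards [hroot.eventually_gt_atTop C, eventually_ge_atTop 1] with N hNC hN
  have hN0 : (0 : ℝ) < N := by exact_mod_cast hN
  filter_upwards [hX] with ω hω n
  induction n with
  | zero => exact fun _ => hs₀
  | succ n ih =>
    intro hn
    -- `|X_n| ≤ C N^{H-1/2}` is below `N^H` as soon as `√N > C`, so every return factor is positive.
    have hbound : |xProc H σ ξ (n + 1) ω| < (N : ℝ) ^ H := by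
      refine (hω (n + 1) (by omega)).trans_lt ?_
      calc C * ((n + 1 : ℕ) : ℝ) ^ (H - 1 / 2) ≤ C * (N : ℝ) ^ (H - 1 / 2) := by
            refine mul_le_mul_of_nonneg_left
              (Real.rpow_le_rpow (by positivity) (by exact_mod_cast hn) (by linarith)) hC.le
        _ < (N : ℝ) ^ (1 / 2 : ℝ) * (N : ℝ) ^ (H - 1 / 2) := by gcongr
        _ = (N : ℝ) ^ H := by
            rw [← Real.rpow_add hN0]
            congr 1
            ring
    refine mul_pos ?_ (ih (by omega))
    have : -1 < xProc H σ ξ (n + 1) ω / (N : ℝ) ^ H := by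
      rw [lt_div_iff₀ (by positivity)]
      linarith [(abs_lt.1 hbound).1]
    linarith

/-- Outside four events of vanishing probability, `T_N > N` and the whole sum is collected. The
first three parts then contribute at least `-ε_N` each and the fourth at least `c`. -/
theorem IsFairSignSequence.exists_tendsto_measure_liquidationValue (hξ : IsFairSignSequence P ξ)
    (hH : 1 / 2 < H) (hH1 : H < 1) (hσ : 0 < σ) (hs₀ : 0 < s₀) :
    ∃ c : ℝ, 0 < c ∧ ∀ C : ℝ, Tendsto (fun N : ℕ => P {ω | c / √(cHat H C N)
      ≤ liquidationValue (stockPrice H σ s₀ ξ N) 0 (psi H σ s₀ C ξ N) N ω}) atTop (𝓝 1) := by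
  obtain ⟨D₁, hD₁⟩ := hξ.exists_measure_theta1_le hH hH1 hσ
  obtain ⟨D₂, hD₂⟩ := hξ.exists_measure_theta2_le hH hH1 hσ
  obtain ⟨D₃, hD₃⟩ := hξ.exists_measure_theta3_le hH hH1 hσ
  obtain ⟨c, hc, h4⟩ := hξ.exists_ae_le_theta4 hH hH1 hσ
  refine ⟨c / 2, by positivity, fun C => ?_⟩
  have hmeas : ∀ n, Measurable (partialSum (theta4 H σ ξ) n) := fun n =>
    (measurable_info_partialSum (d := 1) (n := n) (fun k _ => measurable_info_theta4 k)
      (by omega)).mono (hξ.info_le n) le_rfl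
  let B : (ℕ → Ω → ℝ) → ℕ → Set Ω := fun θ N =>
    {ω | ∃ n ∈ Finset.Icc 1 N, partialSum θ n ω < -(eps H N * N)}
  have hB : Tendsto (fun N => P (B (theta1 H σ ξ) N) + P (B (theta2 H σ ξ) N)
      + P (B (theta3 H σ ξ) N) + P (B (theta4 H σ ξ) N ∪ {ω | partialSum (theta4 H σ ξ) N ω < c * N}))
      atTop (𝓝 0) := by
    have := (((tendsto_measure_drop (H := H) hD₁).add (tendsto_measure_drop (H := H) hD₂)).add
      (tendsto_measure_drop (H := H) hD₃)).add (tendsto_measure_drop_of_ae_le (H := H) hc hmeas h4)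
    rwa [add_zero, add_zero, add_zero] at this
  have hlow := ENNReal.Tendsto.sub (tendsto_const_nhds (x := (1 : ℝ≥0∞)) (f := atTop (α := ℕ))) hB
    (Or.inl ENNReal.one_ne_top)
  rw [tsub_zero] at hlow
  refine tendsto_of_tendsto_of_tendsto_of_le_of_le' hlow tendsto_const_nhds ?_
    (Eventually.of_forall fun N => prob_le_one)
  -- With `ε_N < c / 6`, the three possible losses total less than `c / 2`, leaving a gain of `c /
  -- 2`.
  filter_upwards [hξ.eventually_stockPrice_pos hH hH1 hσ hs₀, eventually_ge_atTop 1,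
    (tendsto_eps hH1).eventually (gt_mem_nhds (show 0 < c / 6 by positivity))] with N hS hN hε
  have hN0 : (0 : ℝ) < N := by exact_mod_cast hN
  set A : Set Ω := {ω | c / 2 / √(cHat H C N)
    ≤ liquidationValue (stockPrice H σ s₀ ξ N) 0 (psi H σ s₀ C ξ N) N ω} with hA
  rw [tsub_le_iff_right]
  have hcover : ∀ᵐ ω ∂P, ω ∈ (Set.univ : Set Ω) → ω ∈ A ∪ (B (theta1 H σ ξ) N
      ∪ B (theta2 H σ ξ) N ∪ B (theta3 H σ ξ) N
      ∪ (B (theta4 H σ ξ) N ∪ {ω | partialSum (theta4 H σ ξ) N ω < c * N})) := by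
    filter_upwards [hS] with ω hω _
    by_contra hcon
    simp only [Set.mem_union, not_or] at hcon
    obtain ⟨hnA, ⟨⟨hn1, hn2⟩, hn3⟩, hn4, hn5⟩ := hcon
    have hdrop : ∀ {θ : ℕ → Ω → ℝ}, ω ∉ B θ N → ∀ m ∈ Finset.Icc 1 N,
        -eps H N ≤ 1 / (N : ℝ) * partialSum θ m ω := by
      intro θ hθ m hm
      have h1 : -(eps H N * N) ≤ partialSum θ m ω := by
        by_contra h
        exact hθ ⟨m, hm, not_le.1 h⟩
      rw [one_div, inv_mul_eq_div, le_div_iff₀ hN0]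
      linarith
    have hT : (N : ℕ∞) < stopTime H σ ξ N ω := by
      rw [lt_stopTime_iff]
      exact fun m hm => ⟨fun _ => hdrop hn1 m hm, fun _ => hdrop hn2 m hm,
        fun _ => hdrop hn3 m hm, fun _ => hdrop hn4 m hm⟩
    obtain ⟨m, -, -, hV, hm⟩ :=
      exists_liquidationValue_psi_eq (H := H) (σ := σ) (s₀ := s₀) (ξ := ξ) C hN ω N
    have hmN : m = N := by
      rcases hm with h | h | h
      · exact h
      · exact absurd hT h
      · exact absurd h (hω N le_rfl).ne'
    subst hmN
    refine hnA ?_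
    rw [hA, Set.mem_ofPred_eq, hV, sum_xProc_mul_eq, div_eq_mul_one_div, mul_comm]
    refine mul_le_mul_of_nonneg_left ?_ (by positivity)
    have hmem : m ∈ Finset.Icc 1 m := Finset.mem_Icc.2 ⟨hN, le_rfl⟩
    have e1 := hdrop hn1 m hmem
    have e2 := hdrop hn2 m hmem
    have e3 := hdrop hn3 m hmem
    have e4 : c ≤ 1 / (m : ℝ) * partialSum (theta4 H σ ξ) m ω := by
      rw [one_div, inv_mul_eq_div, le_div_iff₀ hN0]
      exact not_lt.1 hn5
    simp only [mul_add]
    linarith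
  calc (1 : ℝ≥0∞) = P Set.univ := measure_univ.symm
    _ ≤ P (A ∪ (B (theta1 H σ ξ) N ∪ B (theta2 H σ ξ) N ∪ B (theta3 H σ ξ) N
      ∪ (B (theta4 H σ ξ) N ∪ {ω | partialSum (theta4 H σ ξ) N ω < c * N}))) :=
        measure_mono_ae hcover
    _ ≤ _ := by
        refine (measure_union_le _ _).trans (add_le_add le_rfl ((measure_union_le _ _).trans
          (add_le_add ((measure_union_le _ _).trans
            (add_le_add (measure_union_le _ _) le_rfl)) le_rfl)))

end Arbitrage

end FractionalBinary

theorem mainTheorem1 {Ω : Type*} [MeasurableSpace Ω] (P : Measure Ω) [IsProbabilityMeasure P]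
    (ξ : ℕ → Ω → ℝ) (hξ : FractionalBinary.IsFairSignSequence P ξ)
    (H σ s₀ : ℝ) (hH : 1 / 2 < H) (hH1 : H < 1) (hσ : 0 < σ) (hs₀ : 0 < s₀) :
    (∃ C₁ C₂ : ℝ,
      FractionalBinary.IsThetaBound P H (FractionalBinary.theta1 H σ ξ) C₁ ∧
      FractionalBinary.IsThetaBound P H (FractionalBinary.theta2 H σ ξ) C₂) ∧
    ∀ C₁ C₂ : ℝ,
      FractionalBinary.IsThetaBound P H (FractionalBinary.theta1 H σ ξ) C₁ →
      FractionalBinary.IsThetaBound P H (FractionalBinary.theta2 H σ ξ) C₂ →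
      FractionalBinary.ProvidesStrongAsymptoticArbitrage P ξ
        (fun N => FractionalBinary.stockPrice H σ s₀ ξ N) (fun _ => 0)
        (fun N => FractionalBinary.psi H σ s₀ (C₁ + C₂) ξ N) := by
  obtain ⟨D₁, hD₁⟩ := hξ.exists_isThetaBound_theta1 hH hH1 hσ
  obtain ⟨D₂, hD₂⟩ := hξ.exists_isThetaBound_theta2 hH hH1 hσ
  refine ⟨⟨D₁, D₂, hD₁, hD₂⟩, fun C₁ C₂ h₁ h₂ => ⟨fun N _ =>
    ⟨FractionalBinary.isSelfFinancing_psi _ N, rfl, rfl⟩, ?_⟩⟩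
  obtain ⟨c, hc, hlim⟩ := hξ.exists_tendsto_measure_liquidationValue (s₀ := s₀) hH hH1 hσ hs₀
  have hpos : ∀ N : ℕ, 1 ≤ N → 0 < √(FractionalBinary.cHat H (C₁ + C₂) N) := fun N hN =>
    Real.sqrt_pos.2 (FractionalBinary.cHat_pos H (add_pos h₁.1 h₂.1) hN)
  have hzero : Tendsto (fun N => √(FractionalBinary.cHat H (C₁ + C₂) N)) atTop (𝓝 0) := by
    simpa using (FractionalBinary.tendsto_cHat hH1 (C₁ + C₂)).sqrt
  refine ⟨fun N => √(FractionalBinary.cHat H (C₁ + C₂) N),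
    fun N => c / √(FractionalBinary.cHat H (C₁ + C₂) N),
    fun N hN => ⟨hpos N hN, div_pos hc (hpos N hN)⟩, hzero, ?_,
    fun N hN n hn => FractionalBinary.ae_le_liquidationValue_psi h₁ h₂ hN hn, hlim (C₁ + C₂)⟩
  have hinv : Tendsto (fun N => (√(FractionalBinary.cHat H (C₁ + C₂) N))⁻¹) atTop atTop :=
    tendsto_inv_nhdsGT_zero.comp (tendsto_nhdsWithin_iff.2 ⟨hzero, by
      filter_upwards [eventually_ge_atTop 1] with N hN using hpos N hN⟩)
  simpa only [div_eq_mul_inv] using hinv.const_mul_atTop hc
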